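/- Let $d\ge 2$. The random $d$-process on the vertex set $\{1,\dots,n\}$ starts with the empty graph and at each step adds one edge, chosen uniformly at random among the pairs of distinct vertices that are not yet edges and whose two members both have current degree less than $d$; it stops when there is no such pair. Let $G_s$ be the graph of the process when it has $s$ edges, and let $D_j(s)$ be the number of vertices of degree $j$ in $G_s$. For $n\ge 1$, real $x\ge 0$ and an integer $i\ge 0$ put $\mu=x/n$, $\beta_i(n,x)=n\mu^i e^{-\mu}/i!$, and $$\ell(n,x)=\frac{dn}{2}-\frac12\sum_{i=0}^{d-1}(d-i)\,\beta_i(n,x),$$ which for fixed $n$ is strictly increasing in $x\ge 0$; denote its inverse by $\ell_n^{-1}$. Theorem. Fix integers $d\ge 2$ and $0\le j\le d-1$. There is a constant $C$, depending only on $d$ and $j$, such that the following holds. Let $s=s(n)$ be integers with $1\le s\le dn/2$ for which $x=x(n)=\ell_n^{-1}(s)$ exists for all large $n$, and suppose that $\beta_j(n,x)\to\infty$ as $n\to\infty$. Let $w=w(n)\to\infty$ with $w=o(\beta_j(n,x)^{1/2})$. Then for all sufficiently large $n$, with probability at least $1-C\,w^{-2}$, the process reaches $s$ edges and $$|D_j(s)-\beta_j(n,x)|\le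 w\,\beta_j(n,x)^{1/2}.$$ -/

import Mathlib

open Filter Asymptotics Topology

/-- The degree of the vertex `v` in `G`. -/
noncomputable def vertexDegree {V : Type*} (G : SimpleGraph V) (v : V) : ℕ :=
  (G.neighborSet v).ncard

/-- The number `D_j` of vertices of degree `j` in `G`. -/
noncomputable def degreeCount {V : Type*} (G : SimpleGraph V) (j : ℕ) : ℕ :=
  {v : V | vertexDegree G v = j}.ncard

/-- The pairs of distinct vertices that are not yet edges of `G` and both of whose members are
unsaturated, i.e. have degree less than `d`. -/
def allowedPairs {V : Type*} (d : ℕ) (G : SimpleGraph V) : Set (Sym2 V) :=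
  {e | ¬ e.IsDiag ∧ e ∉ G.edgeSet ∧ ∀ v ∈ e, vertexDegree G v < d}

open Classical in
/-- One step of the `d`-process from `G`: an edge chosen uniformly at random among the allowed
pairs is added. If there is no allowed pair, the process has ended and `G` is kept. -/
noncomputable def edgeStep {V : Type*} [Finite V] (d : ℕ) (G : SimpleGraph V) :
    PMF (SimpleGraph V) :=
  if h : (allowedPairs d G).Nonempty then
    (PMF.uniformOfFinset (Set.toFinite (allowedPairs d G)).toFinset
      ((Set.toFinite (allowedPairs d G)).toFinset_nonempty.mpr h)).map
        (fun e => G ⊔ SimpleGraph.fromEdgeSet {e})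
  else PMF.pure G

/-- The law of the graph of the random `d`-process on `n` vertices after `s` steps, started from
the empty graph. As long as the process has not ended, this is the graph `G_s` with `s` edges. -/
noncomputable def graphLaw (d n : ℕ) : ℕ → PMF (SimpleGraph (Fin n))
  | 0 => PMF.pure ⊥
  | s + 1 => (graphLaw d n s).bind (edgeStep d)

/-- The probability of the event `E` under the discrete law `p`. -/
noncomputable def prob {α : Type*} (p : PMF α) (E : Set α) : ℝ :=
  (p.toOuterMeasure E).toReal

/-- `β_i(n, x) = n μ^i e^{-μ} / i!` with `μ = x / n`. -/
noncomputable def beta (n : ℕ) (x : ℝ) (i : ℕ) : ℝ :=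
  n * (x / n) ^ i * Real.exp (-(x / n)) / (Nat.factorial i : ℝ)

/-- `ℓ(n, x) = dn/2 - (1/2) ∑_{i < d} (d - i) β_i(n, x)`. -/
noncomputable def ell (d n : ℕ) (x : ℝ) : ℝ :=
  (d : ℝ) * n / 2 - 1 / 2 * ∑ i ∈ Finset.range d, ((d : ℝ) - i) * beta n x i

/-! Run a clock that advances by `2 / U` in each step, where `U` is the current number of
unsaturated vertices. The next edge hits a given unsaturated vertex with probability `2 / U + O(1 /
U ^ 2)`, so in clock time each such vertex collects edges almost like a Poisson process of rate 1,
and at time `τ` the number of vertices of degree `i < d` should be near `n` times the Poisson weight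
of mean `τ`.

Fix a target time `T = μ + m` a little beyond `μ = x / n`. For `i < d` the prediction `gapSum i 0 G
(T - τ)` of the degree count at time `T` is almost a martingale. Its squared deviation from `n *
poissonGap i 0 T`, corrected with the function `slack`, is a supermartingale
(`pairMean_potential_le`); the one-step errors are of order `h * exp (-r / 2)` for a clock step `h`
and remaining time `r`, hence summable however long the run. Stopping when the normalized sum of the
`d` potentials reaches 1 (`runFrom_compl_le`) controls all steps at once, without a union bound,
with failure probability `O(ω⁻²)`.

The rest is deterministic. The Poisson transform is inverted by formally using the mean `-r`
(`poissonGap_inversion`), so small deviations of the transforms give the degree counts. The identity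
`∑ (d - a) D_a = d n - 2 |E|` then ties the clock to the number of edges: while edges are missing
the clock stays below `T` (`Admissible.clock_le`), and with `s` edges present it is close to `μ`,
which fixes `D_j` (`Admissible.sq_sub_le`).

The error must be of order `β_j ^ (1/2)` even where lower degrees are far more frequent, that is for
`j ≥ 1` and small `μ`. There the margin is `m = μ`, and the powers of `m` produced by the inversion
offset the larger fluctuations of the lower transforms. -/

/-! ### Poisson weights and their Taylor estimates -/

/-- The probability that a Poisson variable with mean `r` equals `i - a`, and `0` if `i < a`. -/
noncomputable def poissonGap (i a : ℕ) (r : ℝ) : ℝ :=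
  if a ≤ i then r ^ (i - a) * Real.exp (-r) / (Nat.factorial (i - a) : ℝ) else 0

theorem poissonGap_of_lt {i a : ℕ} (h : i < a) (r : ℝ) : poissonGap i a r = 0 := by
  simp [poissonGap, h]

theorem poissonGap_of_le {i a : ℕ} (h : a ≤ i) (r : ℝ) :
    poissonGap i a r = r ^ (i - a) * Real.exp (-r) / (Nat.factorial (i - a) : ℝ) := by
  simp [poissonGap, h]

theorem poissonGap_eq_sub {i a : ℕ} (h : a ≤ i) (r : ℝ) :
    poissonGap i a r = poissonGap (i - a) 0 r := by
  simp [poissonGap, h]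

theorem poissonGap_nonneg (i a : ℕ) {r : ℝ} (hr : 0 ≤ r) : 0 ≤ poissonGap i a r := by
  unfold poissonGap
  split_ifs
  · positivity
  · exact le_rfl

/-- The backward equation of the Poisson process: to first order, shortening the remaining time by
`h` loses what a hit with probability `h` gains. -/
theorem hasDerivAt_poissonGap (i a : ℕ) (r : ℝ) :
    HasDerivAt (poissonGap i a) (poissonGap i (a + 1) r - poissonGap i a r) r := by
  rcases lt_trichotomy a i with h | h | h
  · obtain ⟨k, rfl⟩ : ∃ k, i = a + 1 + k := ⟨i - (a + 1), by omega⟩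
    have e1 : a + 1 + k - a = k + 1 := by omega
    have e2 : a + 1 + k - (a + 1) = k := by omega
    have hf : poissonGap (a + 1 + k) a =
        fun r => r ^ (k + 1) * Real.exp (-r) / (Nat.factorial (k + 1) : ℝ) := by
      funext r
      rw [poissonGap_of_le (by omega), e1]
    rw [hf, poissonGap_of_le (by omega), e2]
    have h1 := (((hasDerivAt_pow (k + 1) r).mul ((hasDerivAt_neg r).exp)).div_const
      (Nat.factorial (k + 1) : ℝ))
    refine h1.congr_deriv ?_
    have : (Nat.factorial k : ℝ) ≠ 0 := by positivity
    rw [Nat.factorial_succ]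
    push_cast
    field_simp
    ring
  · subst h
    have hf : poissonGap a a = fun r => Real.exp (-r) := by
      funext r
      simp [poissonGap]
    rw [hf, poissonGap_of_lt (by omega)]
    exact ((hasDerivAt_neg r).exp).congr_deriv (by ring)
  · have hf : poissonGap i a = fun _ => 0 := by
      funext r
      exact poissonGap_of_lt h r
    rw [hf, poissonGap_of_lt (by omega)]
    simpa using hasDerivAt_const r (0 : ℝ)

/-- Half of the exponent absorbs the power of `r`; the other half survives as a decay uniform in
`a`, which makes the one-step errors summable over an unbounded time. -/
theorem poissonGap_le (i a : ℕ) {r : ℝ} (hr : 0 ≤ r) :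
    poissonGap i a r ≤ 2 ^ i * Real.exp (-r / 2) := by
  unfold poissonGap
  split_ifs with h
  · have h1 : (r / 2) ^ (i - a) / (Nat.factorial (i - a) : ℝ) ≤ Real.exp (r / 2) :=
      Real.pow_div_factorial_le_exp _ (by positivity) _
    have h2 : Real.exp (-r) = Real.exp (-r / 2) * Real.exp (-r / 2) := by
      rw [← Real.exp_add]
      congr 1
      ring
    have h3 : Real.exp (r / 2) * Real.exp (-r / 2) = 1 := by
      rw [← Real.exp_add]
      simp [neg_div]
    calc r ^ (i - a) * Real.exp (-r) / (Nat.factorial (i - a) : ℝ)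
        = 2 ^ (i - a) * ((r / 2) ^ (i - a) / (Nat.factorial (i - a) : ℝ)) *
          (Real.exp (-r / 2) * Real.exp (-r / 2)) := by
          rw [h2, div_pow]
          field_simp
      _ ≤ 2 ^ (i - a) * Real.exp (r / 2) * (Real.exp (-r / 2) * Real.exp (-r / 2)) := by
          gcongr
      _ = 2 ^ (i - a) * Real.exp (-r / 2) := by
          rw [mul_assoc, ← mul_assoc (Real.exp (r / 2)), h3, one_mul]
      _ ≤ 2 ^ i * Real.exp (-r / 2) := by
          gcongr
          · norm_num
          · omega
  · positivity

theorem poissonGap_le_one (i a : ℕ) {r : ℝ} (hr : 0 ≤ r) : poissonGap i a r ≤ 1 := by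
  unfold poissonGap
  split_ifs with h
  · have h1 : r ^ (i - a) / (Nat.factorial (i - a) : ℝ) ≤ Real.exp r :=
      Real.pow_div_factorial_le_exp _ hr _
    rw [mul_div_right_comm, Real.exp_neg, ← div_eq_mul_inv]
    exact (div_le_one (Real.exp_pos r)).2 h1
  · exact zero_le_one

theorem exp_neg_half_le {r ρ : ℝ} (h : r - 1 ≤ ρ) :
    Real.exp (-ρ / 2) ≤ 2 * Real.exp (-r / 2) := by
  have h2 : Real.exp (1 / 2) ≤ 2 := by
    have : Real.exp (1 / 2) * Real.exp (1 / 2) = Real.exp 1 := by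
      rw [← Real.exp_add]
      norm_num
    nlinarith [Real.exp_one_lt_d9, Real.exp_pos (1 / 2 : ℝ)]
  calc Real.exp (-ρ / 2) ≤ Real.exp (1 / 2 + -r / 2) := Real.exp_le_exp.2 (by linarith)
    _ = Real.exp (1 / 2) * Real.exp (-r / 2) := Real.exp_add _ _
    _ ≤ 2 * Real.exp (-r / 2) := by gcongr

theorem abs_poissonGap_succ_sub_le (i a : ℕ) {r ρ : ℝ} (hρ : 0 ≤ ρ) (h : r - 1 ≤ ρ) :
    |poissonGap i (a + 1) ρ - poissonGap i a ρ| ≤ 2 * 2 ^ i * Real.exp (-r / 2) := by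
  have h1 := poissonGap_le i a hρ
  have h2 := poissonGap_le i (a + 1) hρ
  have h3 := poissonGap_nonneg i a hρ
  have h4 := poissonGap_nonneg i (a + 1) hρ
  have h5 : (2 : ℝ) ^ i * Real.exp (-ρ / 2) ≤ 2 ^ i * (2 * Real.exp (-r / 2)) := by
    gcongr
    exact exp_neg_half_le h
  rw [abs_le]
  constructor <;> linarith

theorem abs_poissonGap_sub_le (i a : ℕ) {r ρ : ℝ} (hρ : 0 ≤ ρ) (hr : ρ ≤ r) (h : r - 1 ≤ ρ) :
    |poissonGap i a r - poissonGap i a ρ| ≤ 2 * 2 ^ i * Real.exp (-r / 2) * (r - ρ) := by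
  have := (convex_Icc ρ r).norm_image_sub_le_of_norm_hasDerivWithin_le (f := poissonGap i a)
    (f' := fun t => poissonGap i (a + 1) t - poissonGap i a t)
    (C := 2 * 2 ^ i * Real.exp (-r / 2))
    (fun t _ => (hasDerivAt_poissonGap i a t).hasDerivWithinAt)
    (fun t ht => abs_poissonGap_succ_sub_le i a (hρ.trans ht.1) (h.trans ht.1))
    (Set.left_mem_Icc.2 hr) (Set.right_mem_Icc.2 hr)
  simpa [Real.norm_eq_abs, abs_of_nonneg (sub_nonneg.2 hr)] using this

/-- The expansion is around `ρ`, the remaining time after a step, because that is where the jump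
caused by the new edge is evaluated. -/
theorem abs_poissonGap_taylor_le (i a : ℕ) {r ρ : ℝ} (hρ : 0 ≤ ρ) (hr : ρ ≤ r)
    (h : r - 1 ≤ ρ) :
    |poissonGap i a ρ - poissonGap i a r +
        (r - ρ) * (poissonGap i (a + 1) ρ - poissonGap i a ρ)| ≤
      4 * 2 ^ i * Real.exp (-r / 2) * (r - ρ) ^ 2 * 2 := by
  set c := poissonGap i (a + 1) ρ - poissonGap i a ρ with hc
  have hbound : ∀ t ∈ Set.Icc ρ r,
      ‖poissonGap i (a + 1) t - poissonGap i a t - c‖ ≤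
        4 * 2 ^ i * Real.exp (-r / 2) * (r - ρ) * 2 := by
    intro t ht
    have e : Real.exp (-t / 2) ≤ 2 * Real.exp (-r / 2) := exp_neg_half_le (h.trans ht.1)
    have h0 : 0 ≤ t - ρ := by linarith [ht.1]
    have h0' : t - ρ ≤ r - ρ := by linarith [ht.2]
    have key : ∀ b, |poissonGap i b t - poissonGap i b ρ| ≤
        2 * 2 ^ i * (2 * Real.exp (-r / 2)) * (r - ρ) := by
      intro b
      refine (abs_poissonGap_sub_le i b hρ ht.1 (by linarith [ht.2])).trans ?_
      gcongr
    have k1 := key a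
    have k2 := key (a + 1)
    rw [Real.norm_eq_abs]
    rw [abs_le] at k1 k2 ⊢
    constructor <;> linarith [k1.1, k1.2, k2.1, k2.2]
  have := (convex_Icc ρ r).norm_image_sub_le_of_norm_hasDerivWithin_le
    (f := fun t => poissonGap i a t - c * t)
    (f' := fun t => poissonGap i (a + 1) t - poissonGap i a t - c)
    (fun t _ => by
      have h1 := (hasDerivAt_poissonGap i a t).sub ((hasDerivAt_id t).const_mul c)
      exact (h1.congr_deriv (by ring)).hasDerivWithinAt)
    hbound (Set.left_mem_Icc.2 hr) (Set.right_mem_Icc.2 hr)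
  simp only [Real.norm_eq_abs, abs_of_nonneg (sub_nonneg.2 hr)] at this
  rw [← abs_neg]
  refine le_trans (le_of_eq ?_) (this.trans (le_of_eq ?_))
  · congr 1
    ring
  · ring

/-! ### The error budget -/

/-- The increasing concave function absorbing the accumulated errors. -/
noncomputable def slack (r : ℝ) : ℝ := 1 - Real.exp (-r / 2)

theorem slack_nonneg {r : ℝ} (hr : 0 ≤ r) : 0 ≤ slack r := by
  have : Real.exp (-r / 2) ≤ 1 := Real.exp_le_one_iff.2 (by linarith)
  unfold slack
  linarith

theorem slack_pos {r : ℝ} (hr : 0 < r) : 0 < slack r := by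
  have : Real.exp (-r / 2) < 1 := by
    rw [← Real.exp_zero]
    exact Real.exp_lt_exp.2 (by linarith)
  unfold slack
  linarith

theorem slack_le_one (r : ℝ) : slack r ≤ 1 := by
  have := Real.exp_pos (-r / 2)
  unfold slack
  linarith

theorem slack_le_half (r : ℝ) : slack r ≤ r / 2 := by
  have := Real.add_one_le_exp (-r / 2)
  unfold slack
  linarith

/-- A clock step `h` releases at least half of `h * exp (-r / 2)`, the unit in which all one-step
errors are measured. -/
theorem slack_sub_le (r h : ℝ) : slack (r - h) ≤ slack r - h * Real.exp (-r / 2) / 2 := by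
  unfold slack
  have h1 : Real.exp (-(r - h) / 2) = Real.exp (-r / 2) * Real.exp (h / 2) := by
    rw [← Real.exp_add]
    congr 1
    ring
  have h2 := Real.add_one_le_exp (h / 2)
  rw [h1]
  nlinarith [Real.exp_pos (-r / 2)]

/-! ### Allowed pairs and the mean over the next edge -/

/-- The graph obtained from `G` by adding the edge `e`. -/
def addEdge {V : Type*} (G : SimpleGraph V) (e : Sym2 V) : SimpleGraph V :=
  G ⊔ SimpleGraph.fromEdgeSet {e}

theorem edgeSet_addEdge {V : Type*} {G : SimpleGraph V} {e : Sym2 V} (he : ¬ e.IsDiag) :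
    (addEdge G e).edgeSet = insert e G.edgeSet := by
  ext f
  simp only [addEdge, SimpleGraph.edgeSet_sup, SimpleGraph.edgeSet_fromEdgeSet, Set.mem_union,
    Set.mem_sdiff, Set.mem_singleton_iff, Set.mem_insert_iff]
  constructor
  · rintro (h | ⟨h, _⟩)
    · exact Or.inr h
    · exact Or.inl h
  · rintro (rfl | h)
    · exact Or.inr ⟨rfl, he⟩
    · exact Or.inl h

section Counting

variable {V : Type*} [Fintype V]

open Classical in
/-- The unsaturated vertices, as a finite set. -/
noncomputable def unsaturated (d : ℕ) (G : SimpleGraph V) : Finset V :=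
  Finset.univ.filter fun v => vertexDegree G v < d

/-- The allowed pairs, as a finite set. -/
noncomputable def allowedFinset (d : ℕ) (G : SimpleGraph V) : Finset (Sym2 V) :=
  (Set.toFinite (allowedPairs d G)).toFinset

theorem mem_allowedFinset {d : ℕ} {G : SimpleGraph V} {e : Sym2 V} :
    e ∈ allowedFinset d G ↔ ¬ e.IsDiag ∧ e ∉ G.edgeSet ∧ ∀ v ∈ e, vertexDegree G v < d := by
  simp [allowedFinset, allowedPairs]

theorem mem_unsaturated {d : ℕ} {G : SimpleGraph V} {v : V} :
    v ∈ unsaturated d G ↔ vertexDegree G v < d := by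
  simp [unsaturated]

theorem ncard_edgeSet_addEdge {d : ℕ} {G : SimpleGraph V} {e : Sym2 V}
    (he : e ∈ allowedFinset d G) :
    (addEdge G e).edgeSet.ncard = G.edgeSet.ncard + 1 := by
  rw [mem_allowedFinset] at he
  rw [edgeSet_addEdge he.1, Set.ncard_insert_of_notMem he.2.1 (Set.toFinite _)]

open Classical in
theorem vertexDegree_addEdge {d : ℕ} {G : SimpleGraph V} {e : Sym2 V}
    (he : e ∈ allowedFinset d G) (v : V) :
    vertexDegree (addEdge G e) v = vertexDegree G v + if v ∈ e then 1 else 0 := by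
  rw [mem_allowedFinset] at he
  obtain ⟨hd, hG, -⟩ := he
  have key : ∀ u, (addEdge G e).Adj v u ↔ s(v, u) = e ∨ G.Adj v u := by
    intro u
    rw [← SimpleGraph.mem_edgeSet, edgeSet_addEdge hd, Set.mem_insert_iff,
      SimpleGraph.mem_edgeSet]
  unfold vertexDegree
  split_ifs with hv
  · obtain ⟨u, rfl⟩ := hv
    have : (addEdge G s(v, u)).neighborSet v = insert u (G.neighborSet v) := by
      ext z
      simp only [SimpleGraph.mem_neighborSet, key, Set.mem_insert_iff, Sym2.congr_right]
    rw [this, Set.ncard_insert_of_notMem _ (Set.toFinite _)]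
    simpa using hG
  · have : (addEdge G e).neighborSet v = G.neighborSet v := by
      ext z
      simp only [SimpleGraph.mem_neighborSet, key]
      refine or_iff_right fun h => hv ?_
      rw [← h]
      exact Sym2.mem_mk_left v z
    rw [this, add_zero]

open Classical in
/-- The number of allowed pairs containing `v`. -/
noncomputable def allowedDegree (d : ℕ) (G : SimpleGraph V) (v : V) : ℕ :=
  ((allowedFinset d G).filter fun e => v ∈ e).card

open Classical in
theorem allowedDegree_eq {d : ℕ} {G : SimpleGraph V} {v : V} (hv : v ∈ unsaturated d G) :
    allowedDegree d G v = ((unsaturated d G).filter fun u => u ≠ v ∧ ¬ G.Adj v u).card := by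
  unfold allowedDegree
  symm
  refine Finset.card_bij (fun u _ => s(v, u)) ?_ ?_ ?_
  · intro u hu
    simp only [Finset.mem_filter, mem_unsaturated] at hu
    rw [mem_unsaturated] at hv
    rw [Finset.mem_filter, mem_allowedFinset]
    refine ⟨⟨?_, ?_, ?_⟩, Sym2.mem_mk_left v u⟩
    · simpa using fun h => hu.2.1 h.symm
    · simpa using hu.2.2
    · intro z hz
      rcases Sym2.mem_iff.1 hz with rfl | rfl
      · exact hv
      · exact hu.1
  · intro a _ b _ h
    exact Sym2.congr_right.1 h
  · intro e he
    rw [Finset.mem_filter, mem_allowedFinset] at he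
    obtain ⟨⟨h1, h2, h3⟩, u, rfl⟩ := he
    refine ⟨u, ?_, rfl⟩
    rw [Finset.mem_filter, mem_unsaturated]
    refine ⟨h3 u (Sym2.mem_mk_right v u), ?_, ?_⟩
    · simpa using fun h => h1 h.symm
    · simpa using h2

theorem allowedDegree_le {d : ℕ} {G : SimpleGraph V} {v : V} (hv : v ∈ unsaturated d G) :
    allowedDegree d G v ≤ (unsaturated d G).card := by
  classical
  rw [allowedDegree_eq hv]
  exact Finset.card_filter_le _ _

/-- The only unsaturated vertices lost as partners of `v` are `v` itself and its at most `d - 1`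
neighbours. -/
theorem card_unsaturated_le {d : ℕ} {G : SimpleGraph V} {v : V} (hv : v ∈ unsaturated d G) :
    (unsaturated d G).card ≤ allowedDegree d G v + d := by
  classical
  rw [allowedDegree_eq hv]
  have hsub : unsaturated d G ⊆
      ((unsaturated d G).filter fun u => u ≠ v ∧ ¬ G.Adj v u) ∪
        insert v (Set.toFinite (G.neighborSet v)).toFinset := by
    intro u hu
    by_cases h1 : u = v
    · simp [h1]
    · by_cases h2 : G.Adj v u
      · simp [h2]
      · simp [hu, h1, h2]
  refine (Finset.card_le_card hsub).trans ((Finset.card_union_le _ _).trans ?_)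
  have h1 : (Set.toFinite (G.neighborSet v)).toFinset.card = vertexDegree G v := by
    rw [vertexDegree, Set.ncard_eq_toFinset_card _ (Set.toFinite _)]
  have h2 := Finset.card_insert_le v (Set.toFinite (G.neighborSet v)).toFinset
  have h3 := mem_unsaturated.1 hv
  omega

theorem allowedDegree_eq_zero {d : ℕ} {G : SimpleGraph V} {v : V} (hv : v ∉ unsaturated d G) :
    allowedDegree d G v = 0 := by
  classical
  rw [allowedDegree, Finset.card_eq_zero, Finset.filter_eq_empty_iff]
  intro e he hve
  exact hv (mem_unsaturated.2 ((mem_allowedFinset.1 he).2.2 v hve))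

open Classical in
theorem sum_allowedFinset_sum (d : ℕ) (G : SimpleGraph V) (c : V → ℝ) :
    ∑ e ∈ allowedFinset d G, ∑ v ∈ e.toFinset, c v =
      ∑ v ∈ unsaturated d G, allowedDegree d G v * c v := by
  have h1 : ∀ e : Sym2 V, ∑ v ∈ e.toFinset, c v = ∑ v, if v ∈ e then c v else 0 := by
    intro e
    rw [← Finset.sum_filter]
    congr 1
    ext v
    simp
  simp_rw [h1]
  rw [Finset.sum_comm]
  have h2 : ∀ v, ∑ e ∈ allowedFinset d G, (if v ∈ e then c v else 0) =
      allowedDegree d G v * c v := by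
    intro v
    rw [← Finset.sum_filter, Finset.sum_const, nsmul_eq_mul, allowedDegree]
  simp_rw [h2]
  symm
  refine Finset.sum_subset (Finset.subset_univ _) fun v _ hv => ?_
  rw [allowedDegree_eq_zero hv]
  simp

theorem two_mul_card_allowedFinset (d : ℕ) (G : SimpleGraph V) :
    (2 : ℝ) * (allowedFinset d G).card = ∑ v ∈ unsaturated d G, (allowedDegree d G v : ℝ) := by
  classical
  have h := sum_allowedFinset_sum d G fun _ => 1
  simp only [mul_one] at h
  rw [← h, mul_comm, ← nsmul_eq_mul, ← Finset.sum_const]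
  refine Finset.sum_congr rfl fun e he => ?_
  rw [Finset.sum_const, Sym2.card_toFinset_of_not_isDiag e (mem_allowedFinset.1 he).1]
  simp

/-- The mean of a function of the pair chosen in the next step. -/
noncomputable def pairMean (d : ℕ) (G : SimpleGraph V) (g : Sym2 V → ℝ) : ℝ :=
  (∑ e ∈ allowedFinset d G, g e) / (allowedFinset d G).card

/-- The probability that the pair chosen in the next step contains `v`. -/
noncomputable def hitProb (d : ℕ) (G : SimpleGraph V) (v : V) : ℝ :=
  allowedDegree d G v / (allowedFinset d G).card

open Classical in
theorem pairMean_sum (d : ℕ) (G : SimpleGraph V) (c : V → ℝ) :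
    pairMean d G (fun e => ∑ v ∈ e.toFinset, c v) =
      ∑ v ∈ unsaturated d G, hitProb d G v * c v := by
  rw [pairMean, sum_allowedFinset_sum, Finset.sum_div]
  refine Finset.sum_congr rfl fun v _ => ?_
  rw [hitProb]
  ring

theorem pairMean_add (d : ℕ) (G : SimpleGraph V) (f g : Sym2 V → ℝ) :
    pairMean d G (fun e => f e + g e) = pairMean d G f + pairMean d G g := by
  rw [pairMean, Finset.sum_add_distrib, add_div]
  rfl

theorem pairMean_const_mul (d : ℕ) (G : SimpleGraph V) (a : ℝ) (g : Sym2 V → ℝ) :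
    pairMean d G (fun e => a * g e) = a * pairMean d G g := by
  rw [pairMean, ← Finset.mul_sum, mul_div_assoc]
  rfl

theorem pairMean_sum_fun {ι : Type*} (d : ℕ) (G : SimpleGraph V) (s : Finset ι)
    (g : ι → Sym2 V → ℝ) :
    pairMean d G (fun e => ∑ i ∈ s, g i e) = ∑ i ∈ s, pairMean d G (g i) := by
  rw [pairMean, Finset.sum_comm, Finset.sum_div]
  rfl

theorem pairMean_const {d : ℕ} {G : SimpleGraph V} (h : (allowedFinset d G).Nonempty) (a : ℝ) :
    pairMean d G (fun _ => a) = a := by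
  rw [pairMean, Finset.sum_const, nsmul_eq_mul]
  have : ((allowedFinset d G).card : ℝ) ≠ 0 := by exact_mod_cast h.card_pos.ne'
  field_simp

theorem pairMean_mono {d : ℕ} {G : SimpleGraph V} {f g : Sym2 V → ℝ}
    (h : ∀ e ∈ allowedFinset d G, f e ≤ g e) : pairMean d G f ≤ pairMean d G g := by
  unfold pairMean
  gcongr
  exact h _ ‹_›

theorem pairMean_congr {d : ℕ} {G : SimpleGraph V} {f g : Sym2 V → ℝ}
    (h : ∀ e ∈ allowedFinset d G, f e = g e) : pairMean d G f = pairMean d G g := by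
  unfold pairMean
  rw [Finset.sum_congr rfl h]

theorem le_card_allowedFinset {d : ℕ} {G : SimpleGraph V} :
    ((unsaturated d G).card : ℝ) * ((unsaturated d G).card - d) ≤
      2 * (allowedFinset d G).card := by
  rw [two_mul_card_allowedFinset, ← nsmul_eq_mul, ← Finset.sum_const]
  refine Finset.sum_le_sum fun v hv => ?_
  have : ((unsaturated d G).card : ℝ) ≤ allowedDegree d G v + d := by
    exact_mod_cast card_unsaturated_le hv
  linarith

theorem card_allowedFinset_le {d : ℕ} {G : SimpleGraph V} :
    2 * ((allowedFinset d G).card : ℝ) ≤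
      ((unsaturated d G).card : ℝ) * (unsaturated d G).card := by
  rw [two_mul_card_allowedFinset]
  conv_rhs => rw [← nsmul_eq_mul, ← Finset.sum_const]
  refine Finset.sum_le_sum fun v hv => ?_
  exact_mod_cast allowedDegree_le hv

theorem allowedFinset_nonempty {d : ℕ} {G : SimpleGraph V}
    (hU : 2 * d ≤ (unsaturated d G).card) (hpos : 0 < (unsaturated d G).card) : (allowedFinset d G).Nonempty := by
  rw [← Finset.card_pos]
  have h1 := le_card_allowedFinset (d := d) (G := G)
  have h2 : (2 * d : ℝ) ≤ (unsaturated d G).card := by exact_mod_cast hU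
  have h3 : (0 : ℝ) < (unsaturated d G).card := by exact_mod_cast hpos
  have h4 : (0 : ℝ) < (unsaturated d G).card - d := by
    have : (0 : ℝ) ≤ d := by positivity
    rcases this.eq_or_lt with h | h <;> linarith
  have h5 := mul_pos h3 h4
  have h6 : (0 : ℝ) < (allowedFinset d G).card := by linarith
  exact_mod_cast h6

/-- With `U` unsaturated vertices and `M` allowed pairs, every allowed degree lies in `[U - d, U]`,
and so does their average `2 * M / U`. The assumption `2 * d ≤ U` gives `U ^ 2 ≤ 4 * M` for the
denominator. -/
theorem abs_hitProb_sub_le {d : ℕ} {G : SimpleGraph V}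
    (hU : 2 * d ≤ (unsaturated d G).card) (hpos : 0 < (unsaturated d G).card)
    {v : V} (hv : v ∈ unsaturated d G) :
    |hitProb d G v - 2 / (unsaturated d G).card| ≤
      d * (2 / (unsaturated d G).card : ℝ) ^ 2 := by
  have h1 := le_card_allowedFinset (d := d) (G := G)
  have h1' := card_allowedFinset_le (d := d) (G := G)
  have h2 : (2 * d : ℝ) ≤ (unsaturated d G).card := by exact_mod_cast hU
  have h3 : (0 : ℝ) < (unsaturated d G).card := by exact_mod_cast hpos
  have h4 : (0 : ℝ) < (allowedFinset d G).card := by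
    exact_mod_cast (allowedFinset_nonempty hU hpos).card_pos
  have h5 : ((unsaturated d G).card : ℝ) ≤ allowedDegree d G v + d := by
    exact_mod_cast card_unsaturated_le hv
  have h6 : (allowedDegree d G v : ℝ) ≤ (unsaturated d G).card := by
    exact_mod_cast allowedDegree_le hv
  unfold hitProb
  generalize ((unsaturated d G).card : ℝ) = U at *
  generalize ((allowedFinset d G).card : ℝ) = M at *
  generalize (allowedDegree d G v : ℝ) = a at *
  have hd : (0 : ℝ) ≤ d := by positivity
  generalize (d : ℝ) = D at *
  have hM : U * U ≤ 4 * M := by nlinarith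
  have e : a / M - 2 / U = (a * U - 2 * M) / (M * U) := by
    field_simp
  have e2 : D * (2 / U) ^ 2 = 4 * D / (U * U) := by
    field_simp
    ring
  rw [e, e2, abs_div, abs_of_pos (mul_pos h4 h3), div_le_div_iff₀ (by positivity) (by positivity)]
  have h7 : |a * U - 2 * M| ≤ D * U := by
    rw [abs_le]
    constructor <;> nlinarith
  calc |a * U - 2 * M| * (U * U) ≤ D * U * (4 * M) := by gcongr
    _ = 4 * D * (M * U) := by ring

theorem hitProb_le {d : ℕ} {G : SimpleGraph V}
    (hU : 2 * d ≤ (unsaturated d G).card) (hpos : 0 < (unsaturated d G).card)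
    {v : V} (hv : v ∈ unsaturated d G) :
    hitProb d G v ≤ 2 * (2 / (unsaturated d G).card) := by
  have h1 := le_card_allowedFinset (d := d) (G := G)
  have h2 : (2 * d : ℝ) ≤ (unsaturated d G).card := by exact_mod_cast hU
  have h3 : (0 : ℝ) < (unsaturated d G).card := by exact_mod_cast hpos
  have h4 : (0 : ℝ) < (allowedFinset d G).card := by
    exact_mod_cast (allowedFinset_nonempty hU hpos).card_pos
  have h6 : (allowedDegree d G v : ℝ) ≤ (unsaturated d G).card := by
    exact_mod_cast allowedDegree_le hv
  unfold hitProb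
  generalize ((unsaturated d G).card : ℝ) = U at *
  generalize ((allowedFinset d G).card : ℝ) = M at *
  generalize (allowedDegree d G v : ℝ) = a at *
  have hd : (0 : ℝ) ≤ d := by positivity
  generalize (d : ℝ) = D at *
  have hM : U * U ≤ 4 * M := by nlinarith
  rw [div_le_iff₀ h4]
  have : 2 * (2 / U) * M = 4 * M / U := by ring
  rw [this, le_div_iff₀ h3]
  nlinarith

open Classical in
theorem pairMean_sq_sum_le (d : ℕ) (G : SimpleGraph V) (c : V → ℝ) :
    pairMean d G (fun e => (∑ v ∈ e.toFinset, c v) ^ 2) ≤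
      2 * ∑ v ∈ unsaturated d G, hitProb d G v * c v ^ 2 := by
  rw [← pairMean_sum d G fun v => c v ^ 2, ← pairMean_const_mul]
  refine pairMean_mono fun e he => ?_
  have h := sq_sum_le_card_mul_sum_sq (s := e.toFinset) (f := c)
  rw [Sym2.card_toFinset_of_not_isDiag e (mem_allowedFinset.1 he).1] at h
  exact_mod_cast h

end Counting

/-! ### Drift and variance of the transforms; the supermartingale -/

section Potential

variable {V : Type*} [Fintype V]

/-- The expected number, up to a shift `c` of the degrees, of vertices that reach degree `i` if
every vertex still receives a Poisson number of edges with mean `r`. -/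
noncomputable def gapSum (i c : ℕ) (G : SimpleGraph V) (r : ℝ) : ℝ :=
  ∑ v, poissonGap i (vertexDegree G v + c) r

theorem gapSum_nonneg (i c : ℕ) (G : SimpleGraph V) {r : ℝ} (hr : 0 ≤ r) :
    0 ≤ gapSum i c G r :=
  Finset.sum_nonneg fun _ _ => poissonGap_nonneg _ _ hr

theorem gapSum_eq_sum_unsaturated {d i : ℕ} (hi : i < d) (c : ℕ) (G : SimpleGraph V) (r : ℝ) :
    gapSum i c G r = ∑ v ∈ unsaturated d G, poissonGap i (vertexDegree G v + c) r := by
  symm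
  refine Finset.sum_subset (Finset.subset_univ _) fun v _ hv => ?_
  rw [mem_unsaturated, not_lt] at hv
  exact poissonGap_of_lt (by omega) r

open Classical in
theorem gapSum_addEdge {d : ℕ} (i c : ℕ) {G : SimpleGraph V} {e : Sym2 V}
    (he : e ∈ allowedFinset d G) (r : ℝ) :
    gapSum i c (addEdge G e) r = gapSum i c G r + ∑ v ∈ e.toFinset,
      (poissonGap i (vertexDegree G v + c + 1) r - poissonGap i (vertexDegree G v + c) r) := by
  have h1 : ∀ g : V → ℝ, ∑ v ∈ e.toFinset, g v = ∑ v, if v ∈ e then g v else 0 := by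
    intro g
    rw [← Finset.sum_filter]
    congr 1
    ext v
    simp
  rw [h1, gapSum, gapSum, ← Finset.sum_add_distrib]
  refine Finset.sum_congr rfl fun v _ => ?_
  rw [vertexDegree_addEdge he]
  split_ifs
  · rw [add_right_comm]
    ring
  · simp

/-- The increment of the clock in the step from `G`. -/
noncomputable def clockStep (d : ℕ) (G : SimpleGraph V) : ℝ := 2 / (unsaturated d G).card

theorem clockStep_nonneg (d : ℕ) (G : SimpleGraph V) : 0 ≤ clockStep d G := by
  unfold clockStep
  positivity

theorem card_mul_clockStep {d : ℕ} {G : SimpleGraph V} (h : 0 < (unsaturated d G).card) :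
    (unsaturated d G).card * clockStep d G = 2 := by
  have : ((unsaturated d G).card : ℝ) ≠ 0 := by exact_mod_cast h.ne'
  unfold clockStep
  field_simp

theorem clockStep_le_one {d : ℕ} {G : SimpleGraph V} (h : 2 ≤ (unsaturated d G).card) :
    clockStep d G ≤ 1 := by
  have : (2 : ℝ) ≤ (unsaturated d G).card := by exact_mod_cast h
  unfold clockStep
  exact (div_le_one (by linarith)).2 this

/-- The constant in the bound for the drift of `gapSum`. -/
noncomputable def driftConst (d i : ℕ) : ℝ := 2 ^ i * (4 * d + 16)

theorem driftConst_nonneg (d i : ℕ) : 0 ≤ driftConst d i := by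
  unfold driftConst
  positivity

/-- The passage of the clock and the mean effect of the new edge cancel to first order. Each
unsaturated vertex leaves a Taylor error and an error in its hitting probability, both of order `h ^
2 * exp (-r / 2)`; since `U * h = 2`, summing over the vertices costs one factor `h`. -/
theorem abs_pairMean_gapSum_sub_le {d i : ℕ} (hi : i < d) (c : ℕ) {G : SimpleGraph V}
    (hU : 2 * d ≤ (unsaturated d G).card) {r : ℝ} (hr : clockStep d G ≤ r) :
    |pairMean d G (fun e => gapSum i c (addEdge G e) (r - clockStep d G)) - gapSum i c G r| ≤
      driftConst d i * (clockStep d G * Real.exp (-r / 2)) := by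
  classical
  have hpos : 0 < (unsaturated d G).card := by omega
  have hne := allowedFinset_nonempty hU hpos
  have hUh := card_mul_clockStep hpos
  have hh1 : clockStep d G ≤ 1 := clockStep_le_one (by omega)
  have hh0 := clockStep_nonneg d G
  have hp := fun v (hv : v ∈ unsaturated d G) => abs_hitProb_sub_le hU hpos hv
  change ∀ v ∈ _, |_ - clockStep d G| ≤ d * clockStep d G ^ 2 at hp
  generalize clockStep d G = h at *
  have h1 : pairMean d G (fun e => gapSum i c (addEdge G e) (r - h)) =
      gapSum i c G (r - h) + ∑ v ∈ unsaturated d G, hitProb d G v *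
        (poissonGap i (vertexDegree G v + c + 1) (r - h) -
          poissonGap i (vertexDegree G v + c) (r - h)) := by
    rw [pairMean_congr fun e he => gapSum_addEdge i c he (r - h), pairMean_add,
      pairMean_const hne, pairMean_sum d G fun v =>
        poissonGap i (vertexDegree G v + c + 1) (r - h) -
          poissonGap i (vertexDegree G v + c) (r - h)]
  rw [h1, gapSum_eq_sum_unsaturated hi, gapSum_eq_sum_unsaturated hi, ← Finset.sum_add_distrib,
    ← Finset.sum_sub_distrib]
  have h2 : ∀ v ∈ unsaturated d G,
      |poissonGap i (vertexDegree G v + c) (r - h) + hitProb d G v *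
        (poissonGap i (vertexDegree G v + c + 1) (r - h) -
          poissonGap i (vertexDegree G v + c) (r - h)) -
          poissonGap i (vertexDegree G v + c) r| ≤
        2 ^ i * (2 * d + 8) * Real.exp (-r / 2) * h ^ 2 := by
    intro v hv
    have t1 := abs_poissonGap_taylor_le i (vertexDegree G v + c) (r := r) (ρ := r - h)
      (by linarith) (by linarith) (by linarith)
    have t2 := abs_poissonGap_succ_sub_le i (vertexDegree G v + c) (r := r) (ρ := r - h)
      (by linarith) (by linarith)
    have t3 := hp v hv
    set x := poissonGap i (vertexDegree G v + c + 1) (r - h) -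
          poissonGap i (vertexDegree G v + c) (r - h)
    have e1 : poissonGap i (vertexDegree G v + c) (r - h) + hitProb d G v * x -
          poissonGap i (vertexDegree G v + c) r =
        (poissonGap i (vertexDegree G v + c) (r - h) - poissonGap i (vertexDegree G v + c) r +
          (r - (r - h)) * x) + (hitProb d G v - h) * x := by ring
    rw [e1]
    refine (abs_add_le _ _).trans ?_
    rw [abs_mul]
    have t4 : |hitProb d G v - h| * |x| ≤
        d * h ^ 2 * (2 * 2 ^ i * Real.exp (-r / 2)) := by gcongr
    refine (add_le_add t1 t4).trans (le_of_eq ?_)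
    ring
  refine (Finset.abs_sum_le_sum_abs _ _).trans ((Finset.sum_le_sum h2).trans ?_)
  rw [Finset.sum_const, nsmul_eq_mul]
  calc ((unsaturated d G).card : ℝ) * (2 ^ i * (2 * d + 8) * Real.exp (-r / 2) * h ^ 2)
      = ((unsaturated d G).card * h) * (2 ^ i * (2 * d + 8) * Real.exp (-r / 2) * h) := by ring
    _ = driftConst d i * (h * Real.exp (-r / 2)) := by
        rw [hUh, driftConst]
        ring
    _ ≤ _ := le_rfl

theorem gapSum_sub_clockStep_le {d i : ℕ} (hi : i < d) (c : ℕ) {G : SimpleGraph V}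
    (hU : 2 * d ≤ (unsaturated d G).card) {r : ℝ} (hr : clockStep d G ≤ r) :
    gapSum i c G (r - clockStep d G) ≤ gapSum i c G r + 4 * 2 ^ i := by
  have hUh := card_mul_clockStep (d := d) (G := G) (by omega)
  have hh1 : clockStep d G ≤ 1 := clockStep_le_one (by omega)
  have hh0 := clockStep_nonneg d G
  generalize clockStep d G = h at *
  rw [gapSum_eq_sum_unsaturated hi, gapSum_eq_sum_unsaturated hi]
  have h2 : ∀ v ∈ unsaturated d G, poissonGap i (vertexDegree G v + c) (r - h) ≤
      poissonGap i (vertexDegree G v + c) r + 2 * 2 ^ i * h := by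
    intro v _
    have t1 := abs_poissonGap_sub_le i (vertexDegree G v + c) (r := r) (ρ := r - h)
      (by linarith) (by linarith) (by linarith)
    have t2 : Real.exp (-r / 2) ≤ 1 := Real.exp_le_one_iff.2 (by linarith)
    have t3 : 2 * 2 ^ i * Real.exp (-r / 2) * (r - (r - h)) ≤ 2 * 2 ^ i * 1 * (r - (r - h)) := by
      have : 0 ≤ r - (r - h) := by linarith
      gcongr
    have t4 := (abs_le.1 t1).1
    linarith
  refine (Finset.sum_le_sum h2).trans ?_
  rw [Finset.sum_add_distrib, Finset.sum_const, nsmul_eq_mul]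
  have : ((unsaturated d G).card : ℝ) * (2 * 2 ^ i * h) =
      ((unsaturated d G).card * h) * (2 * 2 ^ i) := by ring
  rw [this, hUh]
  linarith

/-- The constant in the bound for the conditional second moment of the increments. -/
noncomputable def varConst (i : ℕ) : ℝ := 64 * (2 ^ i * 2 ^ i)

-- The jump due to one vertex is a difference of two weights in `[0, B]`, so its square is at most
-- `B` times their sum. The factor `B` keeps the decay, while the weights add up to the transforms:
-- the variance is proportional to the predictions, not to `U`.
open Classical in
theorem pairMean_jump_sq_le {d i : ℕ} (hi : i < d) {G : SimpleGraph V}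
    (hU : 2 * d ≤ (unsaturated d G).card) {r : ℝ} (hr : clockStep d G ≤ r) :
    pairMean d G (fun e => (∑ v ∈ e.toFinset,
      (poissonGap i (vertexDegree G v + 1) (r - clockStep d G) -
        poissonGap i (vertexDegree G v) (r - clockStep d G))) ^ 2) ≤
      varConst i * (clockStep d G * Real.exp (-r / 2)) *
        (gapSum i 0 G r + gapSum i 1 G r + 1) := by
  have hpos : 0 < (unsaturated d G).card := by omega
  have hh1 : clockStep d G ≤ 1 := clockStep_le_one (by omega)
  have hh0 := clockStep_nonneg d G
  have g0 := gapSum_sub_clockStep_le hi 0 hU hr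
  have g1 := gapSum_sub_clockStep_le hi 1 hU hr
  have g2 : 0 ≤ gapSum i 0 G r := gapSum_nonneg i 0 G (hh0.trans hr)
  have g3 : 0 ≤ gapSum i 1 G r := gapSum_nonneg i 1 G (hh0.trans hr)
  have hp := fun v (hv : v ∈ unsaturated d G) => hitProb_le hU hpos hv
  change ∀ v ∈ _, _ ≤ 2 * clockStep d G at hp
  generalize clockStep d G = h at *
  refine (pairMean_sq_sum_le d G fun v => poissonGap i (vertexDegree G v + 1) (r - h) -
        poissonGap i (vertexDegree G v) (r - h)).trans ?_
  have hB : (2 : ℝ) ^ i * Real.exp (-(r - h) / 2) ≤ 2 ^ i * (2 * Real.exp (-r / 2)) := by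
    gcongr
    exact exp_neg_half_le (by linarith)
  have h2 : ∀ v ∈ unsaturated d G, hitProb d G v *
      (poissonGap i (vertexDegree G v + 1) (r - h) - poissonGap i (vertexDegree G v) (r - h)) ^ 2
      ≤ 2 * h * (2 ^ i * (2 * Real.exp (-r / 2))) *
        (poissonGap i (vertexDegree G v + 0) (r - h) +
          poissonGap i (vertexDegree G v + 1) (r - h)) := by
    intro v hv
    rw [add_zero]
    have t1 := (poissonGap_le i (vertexDegree G v) (r := r - h) (by linarith)).trans hB
    have t2 := (poissonGap_le i (vertexDegree G v + 1) (r := r - h) (by linarith)).trans hB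
    have t3 := poissonGap_nonneg i (vertexDegree G v) (r := r - h) (by linarith)
    have t4 := poissonGap_nonneg i (vertexDegree G v + 1) (r := r - h) (by linarith)
    have t5 := hp v hv
    generalize poissonGap i (vertexDegree G v) (r - h) = x at *
    generalize poissonGap i (vertexDegree G v + 1) (r - h) = y at *
    generalize (2 : ℝ) ^ i * (2 * Real.exp (-r / 2)) = B at *
    rw [mul_assoc (2 * h)]
    have t6 : (y - x) ^ 2 ≤ B * (x + y) := by nlinarith
    gcongr
  have h3 := Finset.sum_le_sum h2
  rw [← Finset.mul_sum, Finset.sum_add_distrib, ← gapSum_eq_sum_unsaturated hi,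
    ← gapSum_eq_sum_unsaturated hi] at h3
  have h4 : gapSum i 0 G (r - h) + gapSum i 1 G (r - h) ≤
      8 * 2 ^ i * (gapSum i 0 G r + gapSum i 1 G r + 1) := by
    have : (1 : ℝ) ≤ 2 ^ i := one_le_pow₀ (by norm_num)
    nlinarith
  have h5 : 2 * h * (2 ^ i * (2 * Real.exp (-r / 2))) *
        (gapSum i 0 G (r - h) + gapSum i 1 G (r - h)) ≤
      2 * h * (2 ^ i * (2 * Real.exp (-r / 2))) *
        (8 * 2 ^ i * (gapSum i 0 G r + gapSum i 1 G r + 1)) := by gcongr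
  refine (mul_le_mul_of_nonneg_left (h3.trans h5) zero_le_two).trans (le_of_eq ?_)
  rw [varConst]
  ring

/-- The constant in the bound for the drift of the squared deviation. -/
noncomputable def sqConst (d i : ℕ) : ℝ := 5 * driftConst d i ^ 2 + varConst i

theorem sqConst_pos (d i : ℕ) : 0 < sqConst d i := by
  unfold sqConst varConst
  positivity

theorem pairMean_sq_sub_le {d i : ℕ} (hi : i < d) (b : ℝ) {G : SimpleGraph V}
    (hU : 2 * d ≤ (unsaturated d G).card) {r : ℝ} (hr : clockStep d G ≤ r) :
    pairMean d G (fun e => (gapSum i 0 (addEdge G e) (r - clockStep d G) - b) ^ 2) ≤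
      (gapSum i 0 G r - b) ^ 2 * (1 + clockStep d G * Real.exp (-r / 2) / 4) +
        sqConst d i * (clockStep d G * Real.exp (-r / 2)) *
          (gapSum i 0 G r + gapSum i 1 G r + 1) := by
  classical
  have hpos : 0 < (unsaturated d G).card := by omega
  have hne := allowedFinset_nonempty hU hpos
  have hh1 : clockStep d G ≤ 1 := clockStep_le_one (by omega)
  have hh0 := clockStep_nonneg d G
  have g2 : 0 ≤ gapSum i 0 G r := gapSum_nonneg i 0 G (hh0.trans hr)
  have g3 : 0 ≤ gapSum i 1 G r := gapSum_nonneg i 1 G (hh0.trans hr)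
  have hdrift := abs_pairMean_gapSum_sub_le hi 0 hU hr
  have hjump := pairMean_jump_sq_le hi hU hr
  generalize clockStep d G = h at *
  rw [sqConst]
  have hK := driftConst_nonneg d i
  have he1 : Real.exp (-r / 2) ≤ 1 := Real.exp_le_one_iff.2 (by linarith)
  have ht0 : 0 ≤ h * Real.exp (-r / 2) := by positivity
  have ht1 : h * Real.exp (-r / 2) ≤ 1 := by
    calc h * Real.exp (-r / 2) ≤ 1 * 1 := by gcongr
      _ = 1 := one_mul 1
  generalize h * Real.exp (-r / 2) = t at *
  set J : Sym2 V → ℝ := fun e => ∑ v ∈ e.toFinset,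
      (poissonGap i (vertexDegree G v + 1) (r - h) -
        poissonGap i (vertexDegree G v) (r - h)) with hJ
  set c0 := gapSum i 0 G (r - h) with hc0
  have e1 : ∀ e ∈ allowedFinset d G, gapSum i 0 (addEdge G e) (r - h) = c0 + J e :=
    fun e he => gapSum_addEdge i 0 he (r - h)
  rw [pairMean_congr e1, pairMean_add, pairMean_const hne] at hdrift
  have e2 : pairMean d G (fun e => (gapSum i 0 (addEdge G e) (r - h) - b) ^ 2) =
      (c0 - b) ^ 2 + (2 * (c0 - b) * pairMean d G J + pairMean d G fun e => J e ^ 2) := by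
    rw [pairMean_congr (g := fun e => (c0 - b) ^ 2 + (2 * (c0 - b) * J e + J e ^ 2))
      fun e he => by rw [e1 e he]; ring]
    rw [pairMean_add, pairMean_add, pairMean_const hne, pairMean_const_mul]
  rw [e2]
  change pairMean d G (fun e => J e ^ 2) ≤ _ at hjump
  generalize pairMean d G (fun e => J e ^ 2) = q at *
  generalize pairMean d G J = m at *
  generalize gapSum i 0 G r = x at *
  generalize gapSum i 1 G r = y at *
  generalize driftConst d i = K at *
  set D := c0 + m - x with hD
  -- Completing the square with `c0 + m = x + D`; the discarded term is `-m ^ 2`.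
  have hm : (c0 - b) ^ 2 + (2 * (c0 - b) * m + q) ≤ (x - b) ^ 2 + 2 * (x - b) * D + D ^ 2 + q := by
    rw [hD]
    nlinarith [sq_nonneg m]
  have hD2 : D ^ 2 ≤ K ^ 2 * t := by
    have := sq_le_sq' (abs_le.1 hdrift).1 (abs_le.1 hdrift).2
    have h1 : K ^ 2 * (t * t) ≤ K ^ 2 * (t * 1) := by gcongr
    nlinarith
  have hD1 : 2 * (x - b) * D ≤ t * ((x - b) ^ 2 / 4 + 4 * K ^ 2) := by
    have h1 : 2 * (x - b) * D ≤ 2 * |x - b| * (K * t) := by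
      calc 2 * (x - b) * D ≤ |2 * (x - b) * D| := le_abs_self _
        _ = 2 * |x - b| * |D| := by rw [abs_mul, abs_mul, abs_two]
        _ ≤ _ := by gcongr
    -- The weights are chosen to leave the coefficient `1 / 4`: multiplied by `1 + slack ≤ 2`, it is
    -- just covered by the decrease `t / 2` of `slack`.
    have h2 : 2 * |x - b| * K ≤ (x - b) ^ 2 / 4 + 4 * K ^ 2 := by
      rw [← sq_abs (x - b)]
      nlinarith [sq_nonneg (|x - b| / 2 - 2 * K)]
    nlinarith
  have h5 : 5 * K ^ 2 * t ≤ 5 * K ^ 2 * t * (x + y + 1) :=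
    le_mul_of_one_le_right (by positivity) (by linarith)
  nlinarith

/-- The potential of a state: a supermartingale controlling the squared deviation of `gapSum`
from `b`. -/
noncomputable def potential (d i : ℕ) (b : ℝ) (G : SimpleGraph V) (r : ℝ) : ℝ :=
  (1 + slack r) * (gapSum i 0 G r - b) ^ 2 +
    4 * sqConst d i * slack r * (gapSum i 0 G r + gapSum i 1 G r + 1 + 4 * driftConst d i)

/-- The decrease `t / 2` of `slack`, with `t = h * exp (-r / 2)`, pays for everything: in the first
term for the factor `1 + t / 4`, in the second for the variance, which dictates the coefficient `4 *
sqConst d i`. The summand `4 * driftConst d i` pays for the drift of the two transforms in the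
second term. -/
theorem pairMean_potential_le {d i : ℕ} (hi : i < d) (b : ℝ) {G : SimpleGraph V}
    (hU : 2 * d ≤ (unsaturated d G).card) {r : ℝ} (hr : clockStep d G ≤ r) :
    pairMean d G (fun e => potential d i b (addEdge G e) (r - clockStep d G)) ≤
      potential d i b G r := by
  have hpos : 0 < (unsaturated d G).card := by omega
  have hne := allowedFinset_nonempty hU hpos
  have hh0 := clockStep_nonneg d G
  have g2 : 0 ≤ gapSum i 0 G r := gapSum_nonneg i 0 G (hh0.trans hr)
  have g3 : 0 ≤ gapSum i 1 G r := gapSum_nonneg i 1 G (hh0.trans hr)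
  have hd0 := (abs_le.1 (abs_pairMean_gapSum_sub_le hi 0 hU hr)).2
  have hd1 := (abs_le.1 (abs_pairMean_gapSum_sub_le hi 1 hU hr)).2
  have hsq := pairMean_sq_sub_le hi b hU hr
  have hs := slack_sub_le r (clockStep d G)
  have hs0 : 0 ≤ slack (r - clockStep d G) := slack_nonneg (by linarith)
  have hs1 := slack_le_one (r - clockStep d G)
  unfold potential
  generalize clockStep d G = h at *
  have hK := driftConst_nonneg d i
  have hL := sqConst_pos d i
  have ht0 : 0 ≤ h * Real.exp (-r / 2) := by positivity
  generalize h * Real.exp (-r / 2) = t at *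
  rw [pairMean_add, pairMean_const_mul, pairMean_const_mul, pairMean_add, pairMean_add,
    pairMean_add, pairMean_const hne, pairMean_const hne]
  generalize pairMean d G (fun e => (gapSum i 0 (addEdge G e) (r - h) - b) ^ 2) = Q at *
  generalize pairMean d G (fun e => gapSum i 0 (addEdge G e) (r - h)) = X at *
  generalize pairMean d G (fun e => gapSum i 1 (addEdge G e) (r - h)) = Y at *
  generalize gapSum i 0 G r = x at *
  generalize gapSum i 1 G r = y at *
  generalize driftConst d i = K at *
  generalize sqConst d i = L at *
  generalize slack (r - h) = a' at *
  generalize slack r = a at *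
  have hF := sq_nonneg (x - b)
  generalize (x - b) ^ 2 = F at *
  have hKt : 0 ≤ K * t := mul_nonneg hK ht0
  have k1 : (1 + a') * Q ≤ (1 + a) * F + 2 * L * t * (x + y + 1) := by
    have i1 : (1 + a') * Q ≤ (1 + a') * (F * (1 + t / 4) + L * t * (x + y + 1)) := by gcongr
    have i2 : (1 + a') * (1 + t / 4) ≤ 1 + a := by nlinarith
    have i3 : (1 + a') * (1 + t / 4) * F ≤ (1 + a) * F := by gcongr
    have i4 : (1 + a') * (L * t * (x + y + 1)) ≤ 2 * (L * t * (x + y + 1)) := by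
      gcongr
      linarith
    nlinarith
  have k2 : a' * (X + Y + 1 + 4 * K) ≤
      a * (x + y + 1 + 4 * K) - t / 2 * (x + y + 1) := by
    have i1 : a' * (X + Y + 1 + 4 * K) ≤ a' * (x + y + 1 + 4 * K + 2 * (K * t)) :=
      mul_le_mul_of_nonneg_left (by linarith) hs0
    have i2 : a' * (2 * (K * t)) ≤ 1 * (2 * (K * t)) := by gcongr
    have i3 : a' * (x + y + 1 + 4 * K) ≤ (a - t / 2) * (x + y + 1 + 4 * K) := by gcongr
    nlinarith
  have k3 : 4 * L * (a' * (X + Y + 1 + 4 * K)) ≤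
      4 * L * (a * (x + y + 1 + 4 * K) - t / 2 * (x + y + 1)) := by gcongr
  nlinarith

theorem sq_le_potential (d i : ℕ) (b : ℝ) (G : SimpleGraph V) {r : ℝ} (hr : 0 ≤ r) :
    (gapSum i 0 G r - b) ^ 2 ≤ potential d i b G r := by
  have h1 := slack_nonneg hr
  have h2 := gapSum_nonneg i 0 G hr
  have h3 := gapSum_nonneg i 1 G hr
  have h4 := driftConst_nonneg d i
  have h5 := sqConst_pos d i
  have h6 : 0 ≤ 4 * sqConst d i * slack r *
      (gapSum i 0 G r + gapSum i 1 G r + 1 + 4 * driftConst d i) := by positivity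
  unfold potential
  nlinarith [mul_nonneg h1 (sq_nonneg (gapSum i 0 G r - b))]

theorem gapSum_bot (i c : ℕ) (r : ℝ) :
    gapSum i c (⊥ : SimpleGraph V) r = Fintype.card V * poissonGap i c r := by
  have : ∀ v : V, vertexDegree (⊥ : SimpleGraph V) v = 0 := by
    intro v
    simp [vertexDegree, SimpleGraph.neighborSet]
  simp [gapSum, this]

/-- The empty graph has no deviation, so only the term with `slack` is left. Its smallness for small
`r` is essential when `μ` is small. -/
theorem potential_bot_le (d i : ℕ) {r : ℝ} (hr : 0 ≤ r) :
    potential d i (Fintype.card V * poissonGap i 0 r) (⊥ : SimpleGraph V) r ≤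
      4 * sqConst d i * (1 + 4 * driftConst d i) * (slack r *
        (Fintype.card V * poissonGap i 0 r + Fintype.card V * poissonGap i 1 r + 1)) := by
  unfold potential
  rw [gapSum_bot, gapSum_bot, sub_self]
  have h1 := slack_nonneg hr
  have h2 : 0 ≤ (Fintype.card V : ℝ) * poissonGap i 0 r :=
    mul_nonneg (by positivity) (poissonGap_nonneg i 0 hr)
  have h3 : 0 ≤ (Fintype.card V : ℝ) * poissonGap i 1 r :=
    mul_nonneg (by positivity) (poissonGap_nonneg i 1 hr)
  have h4 := driftConst_nonneg d i
  have h5 := sqConst_pos d i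
  generalize (Fintype.card V : ℝ) * poissonGap i 0 r = x at *
  generalize (Fintype.card V : ℝ) * poissonGap i 1 r = y at *
  have h6 : x + y + 1 + 4 * driftConst d i ≤ (1 + 4 * driftConst d i) * (x + y + 1) := by
    nlinarith [mul_nonneg h4 h2, mul_nonneg h4 h3]
  have h7 : 4 * sqConst d i * slack r * (x + y + 1 + 4 * driftConst d i) ≤
      4 * sqConst d i * slack r * ((1 + 4 * driftConst d i) * (x + y + 1)) := by gcongr
  refine le_trans (le_of_eq ?_) (h7.trans (le_of_eq ?_)) <;> ring

end Potential

/-! ### Optional stopping for the process -/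

/-- The law of the graph after `t` further steps of the `d`-process from `G`. -/
noncomputable def runFrom {V : Type*} [Finite V] (d : ℕ) : ℕ → SimpleGraph V → PMF (SimpleGraph V)
  | 0, G => PMF.pure G
  | t + 1, G => (edgeStep d G).bind (runFrom d t)

theorem graphLaw_bind_runFrom (d n : ℕ) (t k : ℕ) :
    (graphLaw d n k).bind (runFrom d t) = graphLaw d n (k + t) := by
  induction t generalizing k with
  | zero => exact PMF.bind_pure _
  | succ t ih =>
    have h : (graphLaw d n k).bind (runFrom d (t + 1)) =
        (graphLaw d n (k + 1)).bind (runFrom d t) := by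
      rw [graphLaw, PMF.bind_bind]
      rfl
    rw [h, ih, add_right_comm, add_assoc]

theorem runFrom_bot (d n s : ℕ) : runFrom d s (⊥ : SimpleGraph (Fin n)) = graphLaw d n s := by
  have h := graphLaw_bind_runFrom d n s 0
  rwa [zero_add, graphLaw, PMF.pure_bind] at h

theorem edgeStep_bind_toOuterMeasure_le {V : Type*} [Fintype V] {d : ℕ} {G : SimpleGraph V}
    (hne : (allowedFinset d G).Nonempty) (κ : SimpleGraph V → PMF (SimpleGraph V))
    (S : Set (SimpleGraph V)) (g : Sym2 V → ℝ) (hg : ∀ e ∈ allowedFinset d G, 0 ≤ g e)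
    (h : ∀ e ∈ allowedFinset d G,
      (κ (addEdge G e)).toOuterMeasure S ≤ ENNReal.ofReal (g e)) :
    ((edgeStep d G).bind κ).toOuterMeasure S ≤ ENNReal.ofReal (pairMean d G g) := by
  have hne' : (allowedPairs d G).Nonempty := by
    simpa [allowedFinset] using hne
  rw [edgeStep, dif_pos hne', PMF.bind_map, PMF.toOuterMeasure_bind_apply]
  change ∑' e, PMF.uniformOfFinset (allowedFinset d G) hne e *
    (κ (addEdge G e)).toOuterMeasure S ≤ _
  rw [tsum_eq_sum (s := allowedFinset d G)
    fun e he => by rw [PMF.uniformOfFinset_apply_of_notMem hne he, zero_mul]]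
  have hcard : (0 : ℝ) < (allowedFinset d G).card := by exact_mod_cast hne.card_pos
  rw [pairMean, ENNReal.ofReal_div_of_pos hcard, ENNReal.ofReal_sum_of_nonneg hg,
    ENNReal.div_eq_inv_mul, Finset.mul_sum, ENNReal.ofReal_natCast]
  refine Finset.sum_le_sum fun e he => ?_
  rw [PMF.uniformOfFinset_apply_of_mem hne he]
  gcongr
  exact h e he

theorem PMF.toOuterMeasure_le_one {α : Type*} (p : PMF α) (S : Set α) :
    p.toOuterMeasure S ≤ 1 := by
  calc p.toOuterMeasure S ≤ p.toOuterMeasure Set.univ := p.toOuterMeasure.mono (Set.subset_univ _)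
    _ = 1 := (p.toOuterMeasure_apply_eq_one_iff _).2 (Set.subset_univ _)

/-- If a nonnegative function of the graph and the clock is a supermartingale as long as the process
has not been stopped, and is at least `1` in every stopped state outside the target event, then it
bounds the probability of missing the target. -/
theorem runFrom_compl_le {V : Type*} [Fintype V] (d s : ℕ) (T : Set (SimpleGraph V))
    (I : SimpleGraph V → ℝ → Prop) (W : SimpleGraph V → ℝ → ℝ)
    (hW : ∀ G τ, I G τ → 0 ≤ W G τ)
    (hI : ∀ G τ, I G τ → G.edgeSet.ncard ≤ s → 1 ≤ W G τ ∨ (G.edgeSet.ncard = s ∧ G ∈ T) ∨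
      (G.edgeSet.ncard < s ∧ (allowedFinset d G).Nonempty ∧
        (∀ e ∈ allowedFinset d G, I (addEdge G e) (τ + clockStep d G)) ∧
        pairMean d G (fun e => W (addEdge G e) (τ + clockStep d G)) ≤ W G τ)) (t : ℕ) :
    ∀ G τ, I G τ → G.edgeSet.ncard + t = s →
      (runFrom d t G).toOuterMeasure Tᶜ ≤ ENNReal.ofReal (W G τ) := by
  induction t with
  | zero =>
    intro G τ h hs
    rcases hI G τ h (by omega) with h1 | h1 | h1
    · exact (PMF.toOuterMeasure_le_one _ _).trans (ENNReal.one_le_ofReal.2 h1)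
    · rw [runFrom, PMF.toOuterMeasure_pure_apply, if_neg (by simpa using h1.2)]
      exact zero_le
    · omega
  | succ t ih =>
    intro G τ h hs
    -- Stopping needs no stopping time: once `W` is at least 1 the claimed bound is trivial,
    -- whatever the later steps do.
    rcases hI G τ h (by omega) with h1 | h1 | ⟨-, hne, hI', hW'⟩
    · exact (PMF.toOuterMeasure_le_one _ _).trans (ENNReal.one_le_ofReal.2 h1)
    · omega
    · rw [runFrom]
      refine (edgeStep_bind_toOuterMeasure_le hne _ _
        (fun e => W (addEdge G e) (τ + clockStep d G)) (fun e he => hW _ _ (hI' e he))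
        fun e he => ?_).trans (ENNReal.ofReal_le_ofReal hW')
      refine ih _ _ (hI' e he) ?_
      rw [ncard_edgeSet_addEdge he]
      omega

theorem one_sub_le_prob {α : Type*} (p : PMF α) (T : Set α) {ε : ℝ} (hε : 0 ≤ ε)
    (h : p.toOuterMeasure Tᶜ ≤ ENNReal.ofReal ε) : 1 - ε ≤ prob p T := by
  have h1 : (1 : ENNReal) ≤ p.toOuterMeasure T + p.toOuterMeasure Tᶜ := by
    calc (1 : ENNReal) = p.toOuterMeasure (T ∪ Tᶜ) :=
          ((p.toOuterMeasure_apply_eq_one_iff _).2 (by simp)).symm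
      _ ≤ _ := MeasureTheory.measure_union_le _ _
  have hT : p.toOuterMeasure T ≠ ⊤ := ne_top_of_le_ne_top ENNReal.one_ne_top
    (PMF.toOuterMeasure_le_one _ _)
  have h2 := h1.trans (add_le_add_right h (p.toOuterMeasure T))
  have h3 := ENNReal.toReal_mono (ENNReal.add_ne_top.2 ⟨hT, ENNReal.ofReal_ne_top⟩) h2
  rw [ENNReal.toReal_add hT ENNReal.ofReal_ne_top, ENNReal.toReal_ofReal hε,
    ENNReal.toReal_one] at h3
  unfold prob
  linarith

/-! ### Sums over degrees -/

section DegreeSums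

variable {V : Type*} [Fintype V]

theorem sum_comp_vertexDegree (G : SimpleGraph V) (d : ℕ) (g : ℕ → ℝ)
    (hg : ∀ a, d ≤ a → g a = 0) :
    ∑ v, g (vertexDegree G v) = ∑ a ∈ Finset.range d, (degreeCount G a : ℝ) * g a := by
  classical
  have h1 : ∀ a, (degreeCount G a : ℝ) * g a =
      ∑ v, if vertexDegree G v = a then g a else 0 := by
    intro a
    rw [← Finset.sum_filter, Finset.sum_const, nsmul_eq_mul, degreeCount,
      Set.ncard_eq_toFinset_card', Set.toFinset_ofPred]
  simp_rw [h1]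
  rw [Finset.sum_comm]
  refine Finset.sum_congr rfl fun v _ => ?_
  by_cases hv : vertexDegree G v < d
  · rw [Finset.sum_ite_eq, if_pos (Finset.mem_range.2 hv)]
  · rw [hg _ (not_lt.1 hv), Finset.sum_eq_zero]
    intro a ha
    rw [if_neg]
    rintro rfl
    exact hv (Finset.mem_range.1 ha)

theorem sum_vertexDegree (G : SimpleGraph V) :
    ∑ v, (vertexDegree G v : ℝ) = 2 * G.edgeSet.ncard := by
  classical
  have h := G.sum_degrees_eq_twice_card_edges
  have h1 : ∀ v, vertexDegree G v = G.degree v := by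
    intro v
    rw [vertexDegree, Set.ncard_eq_toFinset_card', SimpleGraph.degree,
      SimpleGraph.neighborFinset]
  have h2 : G.edgeSet.ncard = G.edgeFinset.card := by
    rw [Set.ncard_eq_toFinset_card', SimpleGraph.edgeFinset]
  rw [h2]
  simp_rw [h1]
  exact_mod_cast h

/-- This ties the clock to the number of edges. Saturated vertices have degree exactly `d`, hence
miss nothing. -/
theorem sum_sub_mul_degreeCount {d : ℕ} {G : SimpleGraph V} (hG : ∀ v, vertexDegree G v ≤ d) :
    ∑ a ∈ Finset.range d, ((d : ℝ) - a) * degreeCount G a =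
      d * Fintype.card V - 2 * G.edgeSet.ncard := by
  have h := sum_comp_vertexDegree G d (fun a => if a < d then (d : ℝ) - a else 0)
    fun a ha => if_neg (by omega)
  rw [← sum_vertexDegree]
  have h1 : ∑ v, (if vertexDegree G v < d then (d : ℝ) - vertexDegree G v else 0) =
      ∑ v, ((d : ℝ) - vertexDegree G v) := by
    refine Finset.sum_congr rfl fun v _ => ?_
    split_ifs with hv
    · rfl
    · rw [le_antisymm (hG v) (not_lt.1 hv), sub_self]
  rw [h1, Finset.sum_sub_distrib, Finset.sum_const, nsmul_eq_mul, Finset.card_univ] at h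
  rw [mul_comm (d : ℝ), h]
  refine Finset.sum_congr rfl fun a ha => ?_
  rw [if_pos (Finset.mem_range.1 ha), mul_comm]

theorem sum_degreeCount (d : ℕ) (G : SimpleGraph V) :
    ∑ a ∈ Finset.range d, (degreeCount G a : ℝ) = (unsaturated d G).card := by
  classical
  have h := sum_comp_vertexDegree G d (fun a => if a < d then (1 : ℝ) else 0)
    fun a ha => if_neg (by omega)
  rw [Finset.sum_boole] at h
  rw [unsaturated, h]
  refine Finset.sum_congr rfl fun a ha => ?_
  rw [if_pos (Finset.mem_range.1 ha), mul_one]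

theorem gapSum_zero_eq (i : ℕ) (G : SimpleGraph V) (r : ℝ) :
    gapSum i 0 G r = ∑ a ∈ Finset.range (i + 1), (degreeCount G a : ℝ) * poissonGap i a r := by
  rw [gapSum]
  exact sum_comp_vertexDegree G (i + 1) (fun a => poissonGap i a r)
    fun a ha => poissonGap_of_lt (by omega) r

theorem vertexDegree_addEdge_le {d : ℕ} {G : SimpleGraph V} (hG : ∀ v, vertexDegree G v ≤ d)
    {e : Sym2 V} (he : e ∈ allowedFinset d G) (v : V) : vertexDegree (addEdge G e) v ≤ d := by
  classical
  rw [vertexDegree_addEdge he]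
  split_ifs with hv
  · exact (mem_allowedFinset.1 he).2.2 v hv
  · exact hG v

end DegreeSums

/-! ### Inversion of the Poisson transform -/

/-- The semigroup law is the binomial theorem, so it holds for real means of either sign; this is
what permits the inverse mean `-r`. -/
theorem sum_poissonGap_mul (i a : ℕ) (x y : ℝ) :
    ∑ k ∈ Finset.range (i + 1), poissonGap k a x * poissonGap i k y = poissonGap i a (x + y) := by
  by_cases h : a ≤ i
  · obtain ⟨l, rfl⟩ := Nat.exists_eq_add_of_le h
    rw [poissonGap_of_le h, Nat.add_sub_cancel_left, add_assoc, Finset.sum_range_add,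
      Finset.sum_eq_zero fun k hk => by
        rw [poissonGap_of_lt (Finset.mem_range.1 hk), zero_mul], zero_add, add_pow,
      Finset.sum_mul, Finset.sum_div]
    refine Finset.sum_congr rfl fun k hk => ?_
    have hk' : k ≤ l := by
      have := Finset.mem_range.1 hk
      omega
    rw [poissonGap_of_le (by omega), poissonGap_of_le (by omega), Nat.add_sub_cancel_left,
      Nat.add_sub_add_left, neg_add, Real.exp_add, Nat.cast_choose ℝ hk']
    have h1 : (Nat.factorial l : ℝ) ≠ 0 := by positivity
    field_simp
  · rw [poissonGap_of_lt (by omega)]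
    refine Finset.sum_eq_zero fun k hk => ?_
    rw [poissonGap_of_lt (i := k) (by have := Finset.mem_range.1 hk; omega), zero_mul]

theorem poissonGap_at_zero (i a : ℕ) (h : a ≤ i) :
    poissonGap i a 0 = if a = i then 1 else 0 := by
  rw [poissonGap_of_le h]
  split_ifs with h1
  · simp [h1]
  · rw [zero_pow (by omega)]
    simp

/-- Convolution with the Poisson weights of mean `r` is inverted by formally taking `-r`. -/
theorem poissonGap_inversion (E : ℕ → ℝ) (r : ℝ) (i : ℕ) :
    ∑ k ∈ Finset.range (i + 1),
      (∑ a ∈ Finset.range (k + 1), E a * poissonGap k a r) * poissonGap i k (-r) = E i := by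
  have h1 : ∀ k ∈ Finset.range (i + 1),
      (∑ a ∈ Finset.range (k + 1), E a * poissonGap k a r) * poissonGap i k (-r) =
        ∑ a ∈ Finset.range (i + 1), E a * (poissonGap k a r * poissonGap i k (-r)) := by
    intro k hk
    rw [Finset.sum_mul]
    have hk' := Finset.mem_range.1 hk
    refine (Finset.sum_subset (Finset.range_subset_range.2 (by omega)) fun a _ ha => ?_).trans
      (Finset.sum_congr rfl fun a _ => by ring)
    rw [poissonGap_of_lt (i := k) (by simpa using ha), mul_zero, zero_mul]
  rw [Finset.sum_congr rfl h1, Finset.sum_comm]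
  have h2 : ∀ a ∈ Finset.range (i + 1),
      ∑ k ∈ Finset.range (i + 1), E a * (poissonGap k a r * poissonGap i k (-r)) =
        if a = i then E a else 0 := by
    intro a ha
    rw [← Finset.mul_sum, sum_poissonGap_mul, add_neg_cancel,
      poissonGap_at_zero i a (by have := Finset.mem_range.1 ha; omega)]
    split_ifs <;> simp
  rw [Finset.sum_congr rfl h2, Finset.sum_ite_eq', if_pos (by simp)]

/-! ### Poisson mass and deficit -/

/-- The probability that a Poisson variable with mean `t` is less than `d`. -/
noncomputable def poissonMass (d : ℕ) (t : ℝ) : ℝ := ∑ k ∈ Finset.range d, poissonGap k 0 t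

/-- The mean of the positive part of `d - X` for a Poisson variable `X` with mean `t`. -/
noncomputable def poissonDeficit (d : ℕ) (t : ℝ) : ℝ :=
  ∑ k ∈ Finset.range d, ((d : ℝ) - k) * poissonGap k 0 t

theorem poissonDeficit_succ (d : ℕ) (t : ℝ) :
    poissonDeficit (d + 1) t = poissonDeficit d t + poissonMass (d + 1) t := by
  rw [poissonDeficit, poissonDeficit, poissonMass, Finset.sum_range_succ, Finset.sum_range_succ,
    ← add_assoc, ← Finset.sum_add_distrib]
  congr 1
  · refine Finset.sum_congr rfl fun k _ => ?_
    push_cast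
    ring
  · push_cast
    ring

theorem poissonGap_succ_one (k : ℕ) (t : ℝ) : poissonGap (k + 1) 1 t = poissonGap k 0 t := by
  rw [poissonGap_eq_sub (by omega), Nat.add_sub_cancel]

theorem hasDerivAt_poissonMass_succ (d : ℕ) (t : ℝ) :
    HasDerivAt (poissonMass (d + 1)) (-poissonGap d 0 t) t := by
  induction d with
  | zero =>
    have h : poissonMass (0 + 1) = poissonGap 0 0 := by
      funext s
      simp [poissonMass]
    rw [h]
    refine (hasDerivAt_poissonGap 0 0 t).congr_deriv ?_
    rw [poissonGap_of_lt (by omega), zero_sub]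
  | succ d ih =>
    have h : poissonMass (d + 1 + 1) = fun s => poissonMass (d + 1) s + poissonGap (d + 1) 0 s := by
      funext s
      rw [poissonMass, Finset.sum_range_succ]
      rfl
    rw [h]
    refine (ih.add (hasDerivAt_poissonGap (d + 1) 0 t)).congr_deriv ?_
    rw [zero_add, poissonGap_succ_one]
    ring

theorem hasDerivAt_poissonDeficit (d : ℕ) (t : ℝ) :
    HasDerivAt (poissonDeficit d) (-poissonMass d t) t := by
  induction d with
  | zero =>
    have h : poissonDeficit 0 = fun _ => 0 := by
      funext s
      simp [poissonDeficit]
    rw [h]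
    simpa [poissonMass] using hasDerivAt_const t (0 : ℝ)
  | succ d ih =>
    have h : poissonDeficit (d + 1) = fun s => poissonDeficit d s + poissonMass (d + 1) s := by
      funext s
      exact poissonDeficit_succ d s
    rw [h]
    refine (ih.add (hasDerivAt_poissonMass_succ d t)).congr_deriv ?_
    rw [poissonMass, poissonMass, Finset.sum_range_succ]
    ring

theorem poissonMass_antitone (d : ℕ) : AntitoneOn (poissonMass d) (Set.Ici 0) := by
  cases d with
  | zero =>
    intro x _ y _ _
    simp [poissonMass]
  | succ d =>
    refine antitoneOn_of_deriv_nonpos (convex_Ici 0)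
      (fun t _ => (hasDerivAt_poissonMass_succ d t).continuousAt.continuousWithinAt)
      (fun t _ => (hasDerivAt_poissonMass_succ d t).differentiableAt.differentiableWithinAt)
      fun t ht => ?_
    rw [interior_Ici, Set.mem_Ioi] at ht
    rw [(hasDerivAt_poissonMass_succ d t).deriv]
    exact neg_nonpos.2 (poissonGap_nonneg d 0 ht.le)

/-- The deficit falls at a rate equal to the mass, which is antitone and so at least its value at
`T`. This turns errors in the number of missing degrees into errors of the clock. -/
theorem mul_poissonMass_le_poissonDeficit_sub (d : ℕ) {s t T : ℝ} (hs : 0 ≤ s) (hst : s ≤ t)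
    (htT : t ≤ T) :
    (t - s) * poissonMass d T ≤ poissonDeficit d s - poissonDeficit d t := by
  have hd : ∀ y, HasDerivAt (fun x => poissonDeficit d x + poissonMass d T * x)
      (-poissonMass d y + poissonMass d T) y := by
    intro y
    exact ((hasDerivAt_poissonDeficit d y).add ((hasDerivAt_id y).const_mul _)).congr_deriv
      (by ring)
  have h : AntitoneOn (fun x => poissonDeficit d x + poissonMass d T * x) (Set.Icc s T) := by
    refine antitoneOn_of_deriv_nonpos (convex_Icc s T)
      (fun y _ => (hd y).continuousAt.continuousWithinAt)
      (fun y _ => (hd y).differentiableAt.differentiableWithinAt) fun y hy => ?_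
    rw [interior_Icc] at hy
    rw [(hd y).deriv]
    have := poissonMass_antitone d (Set.mem_Ici.2 (hs.trans hy.1.le))
      (Set.mem_Ici.2 (hs.trans (hy.1.le.trans hy.2.le))) hy.2.le
    linarith
  have := h ⟨le_rfl, hst.trans htT⟩ ⟨hst, htT⟩ hst
  simp only at this
  linarith

theorem poissonGap_le_poissonMass {d k : ℕ} (hk : k < d) {t : ℝ} (ht : 0 ≤ t) :
    poissonGap k 0 t ≤ poissonMass d t :=
  Finset.single_le_sum (f := fun k => poissonGap k 0 t)
    (fun i _ => poissonGap_nonneg i 0 ht) (Finset.mem_range.2 hk)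

theorem poissonGap_add_le_poissonMass {d k : ℕ} (hk : k < d) {t m : ℝ} (ht : 0 ≤ t)
    (hm : 0 ≤ m) : poissonGap k 0 (t + m) ≤ poissonMass d t := by
  rw [← sum_poissonGap_mul, poissonMass]
  refine (Finset.sum_le_sum fun a _ => ?_).trans
    (Finset.sum_le_sum_of_subset_of_nonneg (Finset.range_subset_range.2 hk)
      fun a _ _ => poissonGap_nonneg a 0 ht)
  exact mul_le_of_le_one_right (poissonGap_nonneg a 0 ht) (poissonGap_le_one k a hm)

theorem poissonGap_one_add_le_poissonMass {d k : ℕ} (hk : k < d) {t m : ℝ} (ht : 0 ≤ t)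
    (hm : 0 ≤ m) : poissonGap k 1 (t + m) ≤ poissonMass d t := by
  cases k with
  | zero =>
    rw [poissonGap_of_lt (by omega)]
    exact Finset.sum_nonneg fun i _ => poissonGap_nonneg i 0 ht
  | succ k =>
    rw [poissonGap_succ_one]
    exact poissonGap_add_le_poissonMass (by omega) ht hm

theorem exp_one_le_three : Real.exp 1 ≤ 3 := by
  have := Real.exp_one_lt_d9
  linarith

theorem poissonMass_le_three_mul (d : ℕ) {t m : ℝ} (ht : 0 ≤ t) (hm : 0 ≤ m) (hm1 : m ≤ 1) :
    poissonMass d t ≤ 3 * poissonMass d (t + m) := by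
  rw [poissonMass, poissonMass, Finset.mul_sum]
  refine Finset.sum_le_sum fun k _ => ?_
  rw [poissonGap_of_le (Nat.zero_le k), poissonGap_of_le (Nat.zero_le k)]
  have h1 : Real.exp (-t) ≤ 3 * Real.exp (-(t + m)) := by
    calc Real.exp (-t) ≤ Real.exp (1 + -(t + m)) := Real.exp_le_exp.2 (by linarith)
      _ = Real.exp 1 * Real.exp (-(t + m)) := Real.exp_add _ _
      _ ≤ 3 * Real.exp (-(t + m)) := by
        gcongr
        exact exp_one_le_three
  calc t ^ (k - 0) * Real.exp (-t) / (Nat.factorial (k - 0) : ℝ)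
      ≤ (t + m) ^ (k - 0) * (3 * Real.exp (-(t + m))) / (Nat.factorial (k - 0) : ℝ) := by
        gcongr
        linarith
    _ = _ := by ring

theorem poissonMass_le_poissonDeficit (d : ℕ) {t : ℝ} (ht : 0 ≤ t) :
    poissonMass d t ≤ poissonDeficit d t := by
  refine Finset.sum_le_sum fun k hk => ?_
  have : (k : ℝ) + 1 ≤ d := by exact_mod_cast Finset.mem_range.1 hk
  exact le_mul_of_one_le_left (poissonGap_nonneg k 0 ht) (by linarith)

theorem poissonDeficit_le (d : ℕ) {t : ℝ} (ht : 0 ≤ t) :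
    poissonDeficit d t ≤ d * poissonMass d t := by
  rw [poissonMass, Finset.mul_sum]
  refine Finset.sum_le_sum fun k _ => ?_
  have : (0 : ℝ) ≤ k := by positivity
  exact mul_le_mul_of_nonneg_right (by linarith) (poissonGap_nonneg k 0 ht)

theorem abs_poissonGap_neg_le (i k : ℕ) {r : ℝ} (hr : 0 ≤ r) :
    |poissonGap i k (-r)| ≤ r ^ (i - k) * Real.exp r := by
  unfold poissonGap
  split_ifs with h
  · rw [abs_div, abs_mul, abs_pow, abs_neg, abs_of_nonneg hr, neg_neg, Real.abs_exp, Nat.abs_cast]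
    refine div_le_self (by positivity) ?_
    exact_mod_cast Nat.one_le_iff_ne_zero.2 (Nat.factorial_ne_zero _)
  · rw [abs_zero]
    positivity

theorem abs_poissonGap_neg_le_exp (i k : ℕ) {r : ℝ} (hr : 0 ≤ r) :
    |poissonGap i k (-r)| ≤ Real.exp (2 * r) := by
  unfold poissonGap
  split_ifs with h
  · rw [abs_div, abs_mul, abs_pow, abs_neg, abs_of_nonneg hr, neg_neg, Real.abs_exp, Nat.abs_cast,
      mul_div_right_comm, two_mul, Real.exp_add]
    gcongr
    exact Real.pow_div_factorial_le_exp _ hr _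
  · rw [abs_zero]
    positivity

/-! ### From transforms back to degree counts -/

/-- The deviation of the `i`-th Poisson transform of `D` from `N` times the Poisson weight. -/
noncomputable def transformDev (D : ℕ → ℝ) (N r T : ℝ) (i : ℕ) : ℝ :=
  ∑ a ∈ Finset.range (i + 1), D a * poissonGap i a r - N * poissonGap i 0 T

theorem sub_poissonGap_eq_sum_transformDev (D : ℕ → ℝ) (N r τ : ℝ) (i : ℕ) :
    D i - N * poissonGap i 0 τ =
      ∑ k ∈ Finset.range (i + 1), transformDev D N r (τ + r) k * poissonGap i k (-r) := by
  rw [← poissonGap_inversion (fun a => D a - N * poissonGap a 0 τ) r i]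
  refine Finset.sum_congr rfl fun k _ => ?_
  congr 1
  rw [transformDev, ← sum_poissonGap_mul, Finset.mul_sum, ← Finset.sum_sub_distrib]
  refine Finset.sum_congr rfl fun a _ => ?_
  ring

/-- A crude inversion: the loss `exp (2 * r)` is harmless because it is only applied with `r ≤
remBound d`. -/
theorem abs_sub_poissonGap_le {d : ℕ} {D : ℕ → ℝ} {N r τ ν : ℝ} (hr : 0 ≤ r)
    (hF : ∀ i < d, |transformDev D N r (τ + r) i| ≤ ν) {i : ℕ} (hi : i < d) :
    |D i - N * poissonGap i 0 τ| ≤ d * Real.exp (2 * r) * ν := by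
  have hν : 0 ≤ ν := (abs_nonneg _).trans (hF i hi)
  rw [sub_poissonGap_eq_sum_transformDev D N r τ i]
  refine (Finset.abs_sum_le_sum_abs _ _).trans ?_
  have h1 : ∀ k ∈ Finset.range (i + 1),
      |transformDev D N r (τ + r) k * poissonGap i k (-r)| ≤ ν * Real.exp (2 * r) := by
    intro k hk
    rw [abs_mul]
    have := Finset.mem_range.1 hk
    exact mul_le_mul (hF k (by omega)) (abs_poissonGap_neg_le_exp i k hr) (abs_nonneg _) hν
  refine (Finset.sum_le_sum h1).trans ?_
  rw [Finset.sum_const, Finset.card_range, nsmul_eq_mul]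
  have h2 : ((i + 1 : ℕ) : ℝ) ≤ d := by exact_mod_cast hi
  calc ((i + 1 : ℕ) : ℝ) * (ν * Real.exp (2 * r)) ≤ d * (ν * Real.exp (2 * r)) := by gcongr
    _ = _ := by ring

/-- A bound for the remaining time in a state whose transform is close to its expected value. -/
noncomputable def remBound (d : ℕ) : ℝ := 2 * Real.log (7 * d ^ 2 * 2 ^ d)

theorem remBound_nonneg {d : ℕ} (hd : 0 < d) : 0 ≤ remBound d := by
  have h1 : (1 : ℝ) ≤ d := by exact_mod_cast hd
  have h2 : (1 : ℝ) ≤ 2 ^ d := one_le_pow₀ (by norm_num)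
  have h3 : (1 : ℝ) ≤ d ^ 2 := one_le_pow₀ h1
  refine mul_nonneg zero_le_two (Real.log_nonneg ?_)
  nlinarith

/-- With much time left, the decay of the weights would make all transforms tiny compared with `U`;
but up to `ν` they agree with predictions whose sum is at least `U / 3`. The factor 7 in the bound
works since `1 / 7 + 1 / 6 < 1 / 3`. -/
theorem le_remBound {d : ℕ} (hd : 0 < d) {D : ℕ → ℝ} {N r T ν U : ℝ} (hr : 0 ≤ r)
    (hD : ∀ a, 0 ≤ D a) (hU : 0 < U) (hsum : ∑ a ∈ Finset.range d, D a ≤ d * U)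
    (hF : ∀ i < d, |transformDev D N r T i| ≤ ν) (hν : d * ν ≤ U / 6)
    (hmass : U ≤ 3 * (N * poissonMass d T)) : r ≤ remBound d := by
  by_contra! hlt
  have hd' : (1 : ℝ) ≤ d := by exact_mod_cast hd
  set B : ℝ := 7 * d ^ 2 * 2 ^ d with hB
  have hBpos : 0 < B := by positivity
  have he : B * Real.exp (-r / 2) < 1 := by
    have h1 : Real.exp (-r / 2) < Real.exp (-Real.log B) := by
      refine Real.exp_lt_exp.2 ?_
      rw [remBound, ← hB] at hlt
      linarith
    rw [Real.exp_neg, Real.exp_log hBpos] at h1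
    calc B * Real.exp (-r / 2) < B * B⁻¹ := by gcongr
      _ = 1 := mul_inv_cancel₀ hBpos.ne'
  have h1 : ∀ i ∈ Finset.range d, N * poissonGap i 0 T ≤
      2 ^ d * Real.exp (-r / 2) * (d * U) + ν := by
    intro i hi
    have hi' := Finset.mem_range.1 hi
    have h2 := (abs_le.1 (hF i hi')).1
    have h3 : ∑ a ∈ Finset.range (i + 1), D a * poissonGap i a r ≤
        2 ^ d * Real.exp (-r / 2) * (d * U) := by
      calc ∑ a ∈ Finset.range (i + 1), D a * poissonGap i a r
          ≤ ∑ a ∈ Finset.range (i + 1), D a * (2 ^ d * Real.exp (-r / 2)) := by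
            refine Finset.sum_le_sum fun a _ => mul_le_mul_of_nonneg_left ?_ (hD a)
            refine (poissonGap_le i a hr).trans ?_
            gcongr
            norm_num
        _ = (∑ a ∈ Finset.range (i + 1), D a) * (2 ^ d * Real.exp (-r / 2)) := by
            rw [Finset.sum_mul]
        _ ≤ (d * U) * (2 ^ d * Real.exp (-r / 2)) := by
            gcongr
            exact (Finset.sum_le_sum_of_subset_of_nonneg
              (Finset.range_subset_range.2 hi') fun a _ _ => hD a).trans hsum
        _ = _ := mul_comm _ _
    rw [transformDev] at h2
    linarith
  have h2 := Finset.sum_le_sum h1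
  rw [← Finset.mul_sum, Finset.sum_const, Finset.card_range, nsmul_eq_mul] at h2
  change N * poissonMass d T ≤ _ at h2
  have h3 : (d : ℝ) * (2 ^ d * Real.exp (-r / 2) * (d * U)) =
      B * Real.exp (-r / 2) * (U / 7) := by
    rw [hB]
    ring
  have h4 : B * Real.exp (-r / 2) * (U / 7) ≤ 1 * (U / 7) := by gcongr
  rw [mul_add, h3] at h2
  linarith

theorem abs_sum_deficit_sub_le {d : ℕ} {D : ℕ → ℝ} {N τ A : ℝ}
    (hE : ∀ i < d, |D i - N * poissonGap i 0 τ| ≤ A) :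
    |∑ a ∈ Finset.range d, ((d : ℝ) - a) * D a - N * poissonDeficit d τ| ≤ d ^ 2 * A := by
  rw [poissonDeficit, Finset.mul_sum, ← Finset.sum_sub_distrib]
  refine (Finset.abs_sum_le_sum_abs _ _).trans ?_
  have h1 : ∀ a ∈ Finset.range d,
      |((d : ℝ) - a) * D a - N * (((d : ℝ) - a) * poissonGap a 0 τ)| ≤ d * A := by
    intro a ha
    have ha' := Finset.mem_range.1 ha
    have h2 : ((d : ℝ) - a) * D a - N * (((d : ℝ) - a) * poissonGap a 0 τ) =
        ((d : ℝ) - a) * (D a - N * poissonGap a 0 τ) := by ring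
    have h3 : (a : ℝ) < d := by exact_mod_cast ha'
    have h4 : (0 : ℝ) ≤ a := by positivity
    rw [h2, abs_mul, abs_of_pos (sub_pos.2 h3)]
    exact mul_le_mul (by linarith) (hE a ha') (abs_nonneg _) (by positivity)
  refine (Finset.sum_le_sum h1).trans (le_of_eq ?_)
  rw [Finset.sum_const, Finset.card_range, nsmul_eq_mul]
  ring

theorem one_le_remBound {d : ℕ} (hd : 0 < d) : 1 ≤ remBound d := by
  have h1 : (1 : ℝ) ≤ d := by exact_mod_cast hd
  have h2 : (1 : ℝ) ≤ 2 ^ d := one_le_pow₀ (by norm_num)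
  have h3 : (1 : ℝ) ≤ d ^ 2 := one_le_pow₀ h1
  have h4 : Real.exp 1 ≤ 7 * d ^ 2 * 2 ^ d := by
    have := exp_one_le_three
    nlinarith
  have h5 := Real.log_le_log (Real.exp_pos 1) h4
  rw [Real.log_exp] at h5
  unfold remBound
  linarith

/-! ### Comparison of Poisson weights near the target -/

/-- The constant comparing Poisson weights at nearby means. -/
noncomputable def weightConst (j : ℕ) : ℝ := 3 * 2 ^ j * (Nat.factorial j : ℝ)

theorem one_le_weightConst (j : ℕ) : 1 ≤ weightConst j := by
  have h1 : (1 : ℝ) ≤ 2 ^ j := one_le_pow₀ (by norm_num)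
  have h2 : (1 : ℝ) ≤ (Nat.factorial j : ℝ) := by
    exact_mod_cast Nat.one_le_iff_ne_zero.2 (Nat.factorial_ne_zero _)
  unfold weightConst
  nlinarith

section Weights

variable {μ m t : ℝ}

theorem exp_neg_le_three_mul (ht : μ - 1 ≤ t) : Real.exp (-t) ≤ 3 * Real.exp (-μ) := by
  calc Real.exp (-t) ≤ Real.exp (1 + -μ) := Real.exp_le_exp.2 (by linarith)
    _ = Real.exp 1 * Real.exp (-μ) := Real.exp_add _ _
    _ ≤ 3 * Real.exp (-μ) := by
      gcongr
      exact exp_one_le_three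

/-- Each factor `m ≤ μ` supplies one missing power of `μ`, and `t ≤ 2 * μ`. For `j = 0` no power
occurs, so `m` may exceed `μ`. -/
theorem pow_mul_poissonGap_le {i j k : ℕ} (h : i + k = j) (hμ : 0 ≤ μ) (hm : 0 ≤ m)
    (hmj : m ≤ μ ∨ j = 0) (ht0 : 0 ≤ t) (ht : μ - 1 ≤ t) (ht' : t ≤ μ + m) :
    m ^ k * poissonGap i 0 t ≤ weightConst j * poissonGap j 0 μ := by
  have he := exp_neg_le_three_mul ht
  rw [poissonGap_of_le (Nat.zero_le _), poissonGap_of_le (Nat.zero_le _), Nat.sub_zero,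
    Nat.sub_zero, weightConst]
  rcases hmj with hmj | rfl
  · have h1 : (1 : ℝ) ≤ (Nat.factorial i : ℝ) := by
      exact_mod_cast Nat.one_le_iff_ne_zero.2 (Nat.factorial_ne_zero _)
    have h2 : (Nat.factorial j : ℝ) ≠ 0 := by positivity
    have h3 : (2 : ℝ) ^ i ≤ 2 ^ j := by
      gcongr
      · norm_num
      · omega
    calc m ^ k * (t ^ i * Real.exp (-t) / (Nat.factorial i : ℝ))
        ≤ μ ^ k * ((2 * μ) ^ i * (3 * Real.exp (-μ)) / 1) := by
          gcongr
          linarith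
      _ = 3 * 2 ^ i * (μ ^ j * Real.exp (-μ)) := by
          rw [← h, pow_add, mul_pow]
          ring
      _ ≤ 3 * 2 ^ j * (μ ^ j * Real.exp (-μ)) := by gcongr
      _ = _ := by field_simp
  · obtain ⟨rfl, rfl⟩ : i = 0 ∧ k = 0 := by omega
    simpa using he

theorem pow_succ_mul_poissonGap_one_le {i j k : ℕ} (h : i + k = j) (hμ : 0 ≤ μ) (hm : 0 ≤ m)
    (hmj : m ≤ μ ∨ j = 0) (ht0 : 0 ≤ t) (ht : μ - 1 ≤ t) (ht' : t ≤ μ + m) :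
    m ^ (k + 1) * poissonGap i 1 t ≤ weightConst j * poissonGap j 0 μ := by
  cases i with
  | zero =>
    rw [poissonGap_of_lt (by omega), mul_zero]
    exact mul_nonneg (zero_le_one.trans (one_le_weightConst j)) (poissonGap_nonneg j 0 hμ)
  | succ i =>
    rw [poissonGap_succ_one]
    exact pow_mul_poissonGap_le (by omega) hμ hm hmj ht0 ht ht'

theorem poissonGap_le_nine_mul {d i : ℕ} (hi : i < d) (hμ : 0 ≤ μ) (ht0 : 0 ≤ t)
    (ht : μ - 1 ≤ t) (ht' : t ≤ μ + 1) : poissonGap i 0 t ≤ 9 * poissonMass d μ := by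
  refine le_trans ?_ (mul_le_mul_of_nonneg_left
    (poissonGap_add_le_poissonMass hi hμ zero_le_one) (by norm_num))
  rw [poissonGap_of_le (Nat.zero_le _), poissonGap_of_le (Nat.zero_le _)]
  have h1 := exp_neg_le_three_mul ht
  have h2 := exp_neg_le_three_mul (μ := μ) (t := μ) (by linarith)
  have h3 : Real.exp (-t) ≤ 9 * Real.exp (-(μ + 1)) := by
    have := exp_neg_le_three_mul (μ := μ + 1) (t := μ) (by linarith)
    linarith
  calc t ^ (i - 0) * Real.exp (-t) / (Nat.factorial (i - 0) : ℝ)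
      ≤ (μ + 1) ^ (i - 0) * (9 * Real.exp (-(μ + 1))) / (Nat.factorial (i - 0) : ℝ) := by
        gcongr
    _ = _ := by ring

theorem poissonGap_one_le_nine_mul {d i : ℕ} (hi : i < d) (hμ : 0 ≤ μ) (ht0 : 0 ≤ t)
    (ht : μ - 1 ≤ t) (ht' : t ≤ μ + 1) : poissonGap i 1 t ≤ 9 * poissonMass d μ := by
  cases i with
  | zero =>
    rw [poissonGap_of_lt (by omega)]
    exact mul_nonneg (by norm_num) (Finset.sum_nonneg fun k _ => poissonGap_nonneg k 0 hμ)
  | succ i =>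
    rw [poissonGap_succ_one]
    exact poissonGap_le_nine_mul (by omega) hμ ht0 ht ht'

end Weights

/-- The order of magnitude of the squared deviation of the `i`-th transform, for the target time
`T`. -/
noncomputable def varBound (N T : ℝ) (i : ℕ) : ℝ :=
  slack T * (N * poissonGap i 0 T + N * poissonGap i 1 T + 1)

theorem varBound_pos {N T : ℝ} (hN : 0 ≤ N) (hT : 0 < T) (i : ℕ) : 0 < varBound N T i := by
  have h1 := slack_pos hT
  have h2 := poissonGap_nonneg i 0 hT.le
  have h3 := poissonGap_nonneg i 1 hT.le
  unfold varBound
  positivity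

theorem varBound_le {d i : ℕ} (hi : i < d) {N μ m : ℝ} (hN : 0 ≤ N) (hμ : 0 ≤ μ) (hm : 0 ≤ m)
    (hs : slack (μ + m) ≤ m) (hU : 1 ≤ N * poissonMass d μ) :
    varBound N (μ + m) i ≤ 3 * (m * (N * poissonMass d μ)) := by
  have h1 := mul_le_mul_of_nonneg_left (poissonGap_add_le_poissonMass hi hμ hm) hN
  have h2 := mul_le_mul_of_nonneg_left (poissonGap_one_add_le_poissonMass hi hμ hm) hN
  have h3 := slack_nonneg (add_nonneg hμ hm)
  have h4 := poissonGap_nonneg i 0 (add_nonneg hμ hm)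
  have h5 := poissonGap_nonneg i 1 (add_nonneg hμ hm)
  unfold varBound
  calc slack (μ + m) * (N * poissonGap i 0 (μ + m) + N * poissonGap i 1 (μ + m) + 1)
      ≤ m * (N * poissonMass d μ + N * poissonMass d μ + N * poissonMass d μ) := by gcongr
    _ = _ := by ring

/-- One of the two factors `m ^ k` lifts the weights to degree `j`; the other is bounded by 1. The
weight with shift 1 is one degree lower and gets its extra factor `m` from `slack`. -/
theorem pow_mul_varBound_le {i j k : ℕ} (h : i + k = j) {N μ m : ℝ} (hN : 0 ≤ N) (hμ : 0 ≤ μ)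
    (hm : 0 ≤ m) (hm1 : m ≤ 1) (hmj : m ≤ μ ∨ j = 0) (hs : slack (μ + m) ≤ m)
    (hb : 1 ≤ N * poissonGap j 0 μ) :
    (m ^ k) ^ 2 * varBound N (μ + m) i ≤ (2 * weightConst j + 1) * (N * poissonGap j 0 μ) := by
  have hT : 0 ≤ μ + m := add_nonneg hμ hm
  have h1 := mul_le_mul_of_nonneg_left
    (pow_mul_poissonGap_le h hμ hm hmj hT (by linarith) le_rfl) hN
  have h2 := mul_le_mul_of_nonneg_left
    (pow_succ_mul_poissonGap_one_le h hμ hm hmj hT (by linarith) le_rfl) hN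
  have h3 := slack_nonneg hT
  have h4 := poissonGap_nonneg i 0 hT
  have h5 := poissonGap_nonneg i 1 hT
  have h6 : m ^ k ≤ 1 := pow_le_one₀ hm hm1
  have h7 : 0 ≤ m ^ k := by positivity
  unfold varBound
  calc (m ^ k) ^ 2 * (slack (μ + m) *
        (N * poissonGap i 0 (μ + m) + N * poissonGap i 1 (μ + m) + 1))
      ≤ (1 * m ^ k) * (m * (N * poissonGap i 0 (μ + m) + N * poissonGap i 1 (μ + m) + 1)) := by
        rw [sq]
        gcongr
    _ = m * (N * (m ^ k * poissonGap i 0 (μ + m))) + N * (m ^ (k + 1) * poissonGap i 1 (μ + m)) +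
        m ^ k * m := by ring
    _ ≤ 1 * (N * (m ^ k * poissonGap i 0 (μ + m))) + N * (m ^ (k + 1) * poissonGap i 1 (μ + m)) +
        1 * 1 := by gcongr
    _ ≤ _ := by linarith

/-- The amplification of the deviations of the transforms in the count of missing degrees. -/
noncomputable def ampConst (d : ℕ) : ℝ := d ^ 3 * Real.exp (2 * remBound d)

theorem le_ampConst {d : ℕ} (hd : 0 < d) : (d : ℝ) ≤ ampConst d := by
  have h1 : (1 : ℝ) ≤ d := by exact_mod_cast hd
  have h2 : (1 : ℝ) ≤ Real.exp (2 * remBound d) :=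
    Real.one_le_exp (by have := remBound_nonneg hd; linarith)
  unfold ampConst
  calc (d : ℝ) = d ^ 1 * 1 := by ring
    _ ≤ d ^ 3 * Real.exp (2 * remBound d) := by
      gcongr
      · norm_num

theorem abs_deficit_sub_le {d : ℕ} {D : ℕ → ℝ} {N r τ ν : ℝ} (hr : 0 ≤ r)
    (hrR : r ≤ remBound d) (hν : 0 ≤ ν) (hF : ∀ i < d, |transformDev D N r (τ + r) i| ≤ ν) :
    |∑ a ∈ Finset.range d, ((d : ℝ) - a) * D a - N * poissonDeficit d τ| ≤ ampConst d * ν := by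
  have hA : ∀ i < d, |D i - N * poissonGap i 0 τ| ≤ d * Real.exp (2 * remBound d) * ν := by
    intro i hi
    refine (abs_sub_poissonGap_le hr hF hi).trans ?_
    gcongr
  refine (abs_sum_deficit_sub_le hA).trans (le_of_eq ?_)
  rw [ampConst]
  ring

theorem clock_sub_mul_le {d : ℕ} {N μ m τ L X : ℝ} (hN : 0 ≤ N) (hμ : 0 ≤ μ) (hm : 0 ≤ m)
    (hm1 : m ≤ 1) (hτ' : τ ≤ μ + m) (hL : N * poissonDeficit d μ ≤ L)
    (hX : |L - N * poissonDeficit d τ| ≤ X) : (τ - μ) * (N * poissonMass d μ) ≤ 3 * X := by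
  have hX0 : 0 ≤ X := (abs_nonneg _).trans hX
  have hU : 0 ≤ N * poissonMass d μ :=
    mul_nonneg hN (Finset.sum_nonneg fun k _ => poissonGap_nonneg k 0 hμ)
  rcases le_total τ μ with h | h
  · nlinarith
  · have h1 := mul_poissonMass_le_poissonDeficit_sub d hμ h hτ'
    have h2 := poissonMass_le_three_mul d hμ hm hm1
    have h3 := (abs_le.1 hX).2
    have h4 := mul_le_mul_of_nonneg_left h1 hN
    have h5 := mul_le_mul_of_nonneg_left h2 (mul_nonneg hN (sub_nonneg.2 h))
    nlinarith

theorem sub_clock_mul_le {d : ℕ} {N μ m τ X : ℝ} (hN : 0 ≤ N) (hμ : 0 ≤ μ) (hm : 0 ≤ m)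
    (hm1 : m ≤ 1) (hτ : 0 ≤ τ)
    (hX : |N * poissonDeficit d μ - N * poissonDeficit d τ| ≤ X) :
    (μ - τ) * (N * poissonMass d μ) ≤ 3 * X := by
  have hX0 : 0 ≤ X := (abs_nonneg _).trans hX
  have hU : 0 ≤ N * poissonMass d μ :=
    mul_nonneg hN (Finset.sum_nonneg fun k _ => poissonGap_nonneg k 0 hμ)
  rcases le_total μ τ with h | h
  · nlinarith
  · have h1 := mul_poissonMass_le_poissonDeficit_sub d hτ h (le_add_of_nonneg_right hm)
    have h2 := poissonMass_le_three_mul d hμ hm hm1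
    have h3 := (abs_le.1 hX).1
    have h4 := mul_le_mul_of_nonneg_left h1 hN
    have h5 := mul_le_mul_of_nonneg_left h2 (mul_nonneg hN (sub_nonneg.2 h))
    nlinarith

/-- The squared derivative is bounded by a product of two different bounds, one of the order of the
mass `U` and one of order `β_j / m`. Since `(τ - μ) ^ 2 * U` turns out to be of order `m * ω ^ 2`,
both `U` and `m` cancel. -/
theorem sq_mul_poissonGap_sub_le {d j : ℕ} (hj : j < d) {N μ m τ : ℝ} (hN : 0 ≤ N) (hμ : 0 ≤ μ)
    (hm : 0 < m) (hm1 : m ≤ 1) (hmj : m ≤ μ ∨ j = 0) (hτ0 : 0 ≤ τ) (hτ : μ - 1 ≤ τ)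
    (hτ' : τ ≤ μ + m) :
    (N * poissonGap j 0 τ - N * poissonGap j 0 μ) ^ 2 ≤
      18 * weightConst j * (N * poissonMass d μ) * (N * poissonGap j 0 μ) / m * (τ - μ) ^ 2 := by
  set S : Set ℝ := Set.Icc (max 0 (μ - 1)) (μ + m) with hS
  set Z := 18 * weightConst j * (N * poissonMass d μ) * (N * poissonGap j 0 μ) / m with hZ
  have hbound : ∀ t ∈ S, ‖N * (poissonGap j (0 + 1) t - poissonGap j 0 t)‖ ≤ √Z := by
    intro t ht
    have ht0 : 0 ≤ t := (le_max_left _ _).trans ht.1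
    have ht1 : μ - 1 ≤ t := (le_max_right _ _).trans ht.1
    have ht2 : t ≤ μ + m := ht.2
    have a1 := mul_le_mul_of_nonneg_left (poissonGap_le_nine_mul hj hμ ht0 ht1 (by linarith)) hN
    have a2 := mul_le_mul_of_nonneg_left
      (poissonGap_one_le_nine_mul hj hμ ht0 ht1 (by linarith)) hN
    have a3 := mul_le_mul_of_nonneg_left
      (pow_mul_poissonGap_le (add_zero j) hμ hm.le hmj ht0 ht1 ht2) hN
    have a4 := mul_le_mul_of_nonneg_left
      (pow_succ_mul_poissonGap_one_le (add_zero j) hμ hm.le hmj ht0 ht1 ht2) hN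
    have a5 := mul_nonneg hN (poissonGap_nonneg j 0 ht0)
    have a6 := mul_nonneg hN (poissonGap_nonneg j 1 ht0)
    rw [Real.norm_eq_abs]
    refine Real.abs_le_sqrt ?_
    rw [hZ, le_div_iff₀ hm, zero_add, mul_sub]
    rw [pow_zero, one_mul] at a3
    rw [zero_add, pow_one, mul_left_comm, mul_left_comm N (weightConst j)] at a4
    rw [mul_left_comm] at a1 a2 a3
    generalize N * poissonGap j 0 t = y at *
    generalize N * poissonGap j 1 t = x at *
    have b0 : 0 ≤ N * poissonMass d μ :=
      mul_nonneg hN (Finset.sum_nonneg fun k _ => poissonGap_nonneg k 0 hμ)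
    generalize N * poissonMass d μ = U at *
    generalize N * poissonGap j 0 μ = b at *
    have b1 : y * m ≤ weightConst j * b := (mul_le_of_le_one_right a5 hm1).trans a3
    have b2 : x * m ≤ weightConst j * b := by linarith
    have b3 : y * (y * m) ≤ 9 * U * (weightConst j * b) :=
      mul_le_mul a1 b1 (by positivity) (by positivity)
    have b4 : x * (x * m) ≤ 9 * U * (weightConst j * b) :=
      mul_le_mul a2 b2 (by positivity) (by positivity)
    nlinarith [mul_nonneg (mul_nonneg a5 a6) hm.le]
  have hZ0 : 0 ≤ Z := by
    have h1 := one_le_weightConst j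
    have h2 := poissonGap_nonneg j 0 hμ
    have h3 : 0 ≤ poissonMass d μ := Finset.sum_nonneg fun k _ => poissonGap_nonneg k 0 hμ
    rw [hZ]
    positivity
  have h := (convex_Icc (max 0 (μ - 1)) (μ + m)).norm_image_sub_le_of_norm_hasDerivWithin_le
    (f := fun t => N * poissonGap j 0 t)
    (fun t _ => ((hasDerivAt_poissonGap j 0 t).const_mul N).hasDerivWithinAt) hbound
    (x := μ) (y := τ) ⟨max_le hμ (by linarith), by linarith⟩ ⟨max_le hτ0 hτ, hτ'⟩
  rw [Real.norm_eq_abs, Real.norm_eq_abs] at h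
  calc (N * poissonGap j 0 τ - N * poissonGap j 0 μ) ^ 2
      = |N * poissonGap j 0 τ - N * poissonGap j 0 μ| ^ 2 := (sq_abs _).symm
    _ ≤ (√Z * |τ - μ|) ^ 2 := by gcongr
    _ = Z * (τ - μ) ^ 2 := by rw [mul_pow, Real.sq_sqrt hZ0, sq_abs]

/-- A sharper inversion than `abs_sub_poissonGap_le`: for `r ≤ 2 * m` the inverse weights are of
order `m ^ (j - k)`, which compensates the larger deviations of the transforms of lower degree. -/
theorem sq_sub_poissonGap_le {d j : ℕ} (hj : j < d) {D : ℕ → ℝ} {N μ m τ r ω : ℝ} (hN : 0 ≤ N)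
    (hμ : 0 ≤ μ) (hm : 0 ≤ m) (hm1 : m ≤ 1) (hmj : m ≤ μ ∨ j = 0) (hs : slack (μ + m) ≤ m)
    (hb : 1 ≤ N * poissonGap j 0 μ) (hτr : τ + r = μ + m) (hr : 0 ≤ r) (hrm : r ≤ 2 * m)
    (hF : ∀ i < d, transformDev D N r (μ + m) i ^ 2 ≤ ω ^ 2 * varBound N (μ + m) i) :
    (D j - N * poissonGap j 0 τ) ^ 2 ≤
      81 * (j + 1) ^ 2 * (2 ^ j) ^ 2 * (2 * weightConst j + 1) *
        (ω ^ 2 * (N * poissonGap j 0 μ)) := by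
  rw [sub_poissonGap_eq_sum_transformDev D N r τ j, hτr]
  have he : Real.exp r ≤ 9 := by
    calc Real.exp r ≤ Real.exp (1 + 1) := Real.exp_le_exp.2 (by linarith)
      _ = Real.exp 1 * Real.exp 1 := Real.exp_add _ _
      _ ≤ 3 * 3 := by
        gcongr <;> exact exp_one_le_three
      _ = 9 := by norm_num
  have h1 : ∀ k ∈ Finset.range (j + 1),
      (transformDev D N r (μ + m) k * poissonGap j k (-r)) ^ 2 ≤
        81 * (2 ^ j) ^ 2 * (2 * weightConst j + 1) * (ω ^ 2 * (N * poissonGap j 0 μ)) := by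
    intro k hk
    have hk' := Finset.mem_range.1 hk
    have a1 : |poissonGap j k (-r)| ≤ 9 * 2 ^ j * m ^ (j - k) := by
      calc |poissonGap j k (-r)| ≤ r ^ (j - k) * Real.exp r := abs_poissonGap_neg_le j k hr
        _ ≤ (2 * m) ^ (j - k) * 9 := by gcongr
        _ = 9 * 2 ^ (j - k) * m ^ (j - k) := by
          rw [mul_pow]
          ring
        _ ≤ 9 * 2 ^ j * m ^ (j - k) := by
          gcongr
          · norm_num
          · omega
    have a2 : poissonGap j k (-r) ^ 2 ≤ (9 * 2 ^ j * m ^ (j - k)) ^ 2 := by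
      rw [← sq_abs]
      gcongr
    have a3 := pow_mul_varBound_le (i := k) (j := j) (k := j - k) (by omega) hN hμ hm hm1 hmj hs hb
    rw [mul_pow]
    calc transformDev D N r (μ + m) k ^ 2 * poissonGap j k (-r) ^ 2
        ≤ (ω ^ 2 * varBound N (μ + m) k) * (9 * 2 ^ j * m ^ (j - k)) ^ 2 :=
          mul_le_mul (hF k (by omega)) a2 (sq_nonneg _) ((sq_nonneg _).trans (hF k (by omega)))
      _ = 81 * (2 ^ j) ^ 2 * ω ^ 2 * ((m ^ (j - k)) ^ 2 * varBound N (μ + m) k) := by ring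
      _ ≤ 81 * (2 ^ j) ^ 2 * ω ^ 2 * ((2 * weightConst j + 1) * (N * poissonGap j 0 μ)) := by
          gcongr
      _ = _ := by ring
  refine sq_sum_le_card_mul_sum_sq.trans ?_
  rw [Finset.card_range]
  have h2 := Finset.sum_le_sum h1
  rw [Finset.sum_const, Finset.card_range, nsmul_eq_mul] at h2
  refine (mul_le_mul_of_nonneg_left h2 (Nat.cast_nonneg _)).trans (le_of_eq ?_)
  push_cast
  ring

/-! ### Deterministic analysis of a good state -/

/-- The constant in the bound for the squared deviation of the degree count. -/
noncomputable def devConst (d j : ℕ) : ℝ :=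
  2 * (486 * weightConst j * ampConst d ^ 2 +
    81 * (j + 1) ^ 2 * (2 ^ j) ^ 2 * (2 * weightConst j + 1))

theorem devConst_pos (d j : ℕ) : 0 < devConst d j := by
  have := one_le_weightConst j
  unfold devConst
  positivity

/-- The parameters of the analysis: `N` vertices, time `μ` and margin `m`, for the degree `j`. -/
structure Admissible (d j : ℕ) (N μ m : ℝ) : Prop where
  lt : j < d
  nonneg : 0 ≤ N
  time_pos : 0 < μ
  margin_pos : 0 < m
  margin_le_one : m ≤ 1
  margin_le : m ≤ μ ∨ j = 0
  slack_le : slack (μ + m) ≤ m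
  one_le : 1 ≤ N * poissonGap j 0 μ
  le_margin_mul : N * poissonGap j 0 μ ≤ m * (N * poissonMass d μ)

namespace Admissible

theorem one_le_mass {d j : ℕ} {N μ m : ℝ} (h : Admissible d j N μ m) :
    1 ≤ N * poissonMass d μ :=
  h.one_le.trans (mul_le_mul_of_nonneg_left (poissonGap_le_poissonMass h.lt h.time_pos.le) h.nonneg)

/-- The deviation of all transforms is bounded by a small multiple of `m` times the mass. -/
theorem exists_uniform_bound {d j : ℕ} {N μ m : ℝ} (h : Admissible d j N μ m) {ω : ℝ}
    (hω : 3 * (7 * ampConst d) ^ 2 * ω ^ 2 ≤ N * poissonGap j 0 μ) {D : ℕ → ℝ} {r : ℝ}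
    (hF : ∀ i < d, transformDev D N r (μ + m) i ^ 2 ≤ ω ^ 2 * varBound N (μ + m) i) :
    ∃ ν, 0 ≤ ν ∧ (∀ i < d, |transformDev D N r (μ + m) i| ≤ ν) ∧
      ν ^ 2 = 3 * ω ^ 2 * (m * (N * poissonMass d μ)) ∧
      7 * (ampConst d * ν) ≤ m * (N * poissonMass d μ) := by
  have hmU : 0 ≤ m * (N * poissonMass d μ) :=
    mul_nonneg h.margin_pos.le (zero_le_one.trans h.one_le_mass)
  have hν2 : √(3 * ω ^ 2 * (m * (N * poissonMass d μ))) ^ 2 =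
      3 * ω ^ 2 * (m * (N * poissonMass d μ)) := Real.sq_sqrt (by positivity)
  refine ⟨√(3 * ω ^ 2 * (m * (N * poissonMass d μ))), Real.sqrt_nonneg _, ?_, hν2, ?_⟩
  · intro i hi
    refine Real.abs_le_sqrt ((hF i hi).trans ?_)
    have := varBound_le hi h.nonneg h.time_pos.le h.margin_pos.le h.slack_le h.one_le_mass
    calc ω ^ 2 * varBound N (μ + m) i ≤ ω ^ 2 * (3 * (m * (N * poissonMass d μ))) := by gcongr
      _ = _ := by ring
  · refine le_of_sq_le_sq ?_ hmU
    have : (7 * (ampConst d * √(3 * ω ^ 2 * (m * (N * poissonMass d μ))))) ^ 2 =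
        3 * (7 * ampConst d) ^ 2 * ω ^ 2 * (m * (N * poissonMass d μ)) := by
      rw [mul_pow, mul_pow, hν2]
      ring
    rw [this, sq (m * _)]
    -- The assumption on `ω` is relative to `β_j`; the margin condition `β_j ≤ m * U` makes it
    -- relative to `m * U`.
    exact mul_le_mul_of_nonneg_right (hω.trans h.le_margin_mul) hmU

/-- With small deviations, the clock cannot be late while edges are still missing. -/
theorem clock_le {d j : ℕ} {N μ m : ℝ} (h : Admissible d j N μ m) {ω : ℝ}
    (hω : 3 * (7 * ampConst d) ^ 2 * ω ^ 2 ≤ N * poissonGap j 0 μ) {D : ℕ → ℝ} {τ : ℝ}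
    (hτ' : τ ≤ μ + m)
    (hF : ∀ i < d, transformDev D N (μ + m - τ) (μ + m) i ^ 2 ≤ ω ^ 2 * varBound N (μ + m) i)
    (hL : N * poissonDeficit d μ ≤ ∑ a ∈ Finset.range d, ((d : ℝ) - a) * D a) :
    τ ≤ μ + m / 2 := by
  by_contra! hlt
  obtain ⟨ν, hν0, hν, -, hν'⟩ := h.exists_uniform_bound hω hF
  have hm := h.margin_pos
  have hm1 := h.margin_le_one
  have hU := h.one_le_mass
  have hR := one_le_remBound (Nat.zero_lt_of_lt h.lt)
  have hX := abs_deficit_sub_le (d := d) (D := D) (N := N) (r := μ + m - τ) (τ := τ)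
    (by linarith) (by linarith) hν0 (by
      rw [add_sub_cancel]
      exact hν)
  -- This gives `τ - μ ≤ 3 * m / 7`, below `m / 2`: hence the 7 in `exists_uniform_bound`.
  have h1 := clock_sub_mul_le h.nonneg h.time_pos.le hm.le hm1 hτ' hL hX
  have h2 : m / 2 * (N * poissonMass d μ) ≤ (τ - μ) * (N * poissonMass d μ) := by
    gcongr
    linarith
  nlinarith [mul_pos hm (zero_lt_one.trans_le hU)]

/-- With small deviations and no missing edge, the degree count is close to its expected value. -/
theorem sq_sub_le {d j : ℕ} {N μ m : ℝ} (h : Admissible d j N μ m) {ω : ℝ}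
    (hω : 3 * (7 * ampConst d) ^ 2 * ω ^ 2 ≤ N * poissonGap j 0 μ) {D : ℕ → ℝ}
    (hD : ∀ a, 0 ≤ D a) {τ : ℝ} (hτ0 : 0 ≤ τ) (hτ' : τ ≤ μ + m)
    (hF : ∀ i < d, transformDev D N (μ + m - τ) (μ + m) i ^ 2 ≤ ω ^ 2 * varBound N (μ + m) i)
    (hL : ∑ a ∈ Finset.range d, ((d : ℝ) - a) * D a = N * poissonDeficit d μ) :
    (D j - N * poissonGap j 0 μ) ^ 2 ≤ devConst d j * ω ^ 2 * (N * poissonGap j 0 μ) := by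
  obtain ⟨ν, hν0, hν, hν2, hν'⟩ := h.exists_uniform_bound hω hF
  have hd : 0 < d := Nat.zero_lt_of_lt h.lt
  have hm := h.margin_pos
  have hm1 := h.margin_le_one
  have hμ := h.time_pos
  have hN := h.nonneg
  have hU := h.one_le_mass
  have hUpos : 0 < N * poissonMass d μ := by linarith
  have hr : 0 ≤ μ + m - τ := by linarith
  have hmU : m * (N * poissonMass d μ) ≤ N * poissonMass d μ := by nlinarith
  have hamp := mul_le_mul_of_nonneg_right (le_ampConst hd) hν0
  have hsum : ∑ a ∈ Finset.range d, D a ≤ d * (N * poissonMass d μ) := by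
    calc ∑ a ∈ Finset.range d, D a ≤ ∑ a ∈ Finset.range d, ((d : ℝ) - a) * D a := by
          refine Finset.sum_le_sum fun a ha => le_mul_of_one_le_left (hD a) ?_
          have : (a : ℝ) + 1 ≤ d := by exact_mod_cast Finset.mem_range.1 ha
          linarith
      _ = N * poissonDeficit d μ := hL
      _ ≤ N * (d * poissonMass d μ) := mul_le_mul_of_nonneg_left (poissonDeficit_le d hμ.le) hN
      _ = _ := by ring
  -- Nothing yet prevents the clock from being far behind, so the remaining time must be bounded
  -- before the inversion can be used.
  have hrem : μ + m - τ ≤ remBound d := by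
    refine le_remBound hd hr hD hUpos hsum hν (by linarith) ?_
    have := mul_le_mul_of_nonneg_left (poissonMass_le_three_mul d hμ.le hm.le hm1) hN
    linarith
  have hX := abs_deficit_sub_le (d := d) (D := D) (N := N) hr hrem hν0 (by
    rw [add_sub_cancel]
    exact hν)
  have c1 := clock_sub_mul_le hN hμ.le hm.le hm1 hτ' hL.ge hX
  rw [hL] at hX
  have c2 := sub_clock_mul_le hN hμ.le hm.le hm1 hτ0 hX
  have hδ : |τ - μ| * (N * poissonMass d μ) ≤ 3 * (ampConst d * ν) := by
    rcases abs_cases (τ - μ) with ⟨he, -⟩ | ⟨he, -⟩ <;> rw [he] <;> linarith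
  have hδm : |τ - μ| ≤ m := by
    refine le_of_mul_le_mul_right (hδ.trans ?_) hUpos
    have : 0 ≤ ampConst d * ν := (mul_nonneg (Nat.cast_nonneg d) hν0).trans hamp
    linarith
  -- The square of `hδ` with `ν ^ 2` inserted; one factor of the mass cancels and `27 = 9 * 3`.
  have hδ2 : (τ - μ) ^ 2 * (N * poissonMass d μ) ≤ 27 * ampConst d ^ 2 * ω ^ 2 * m := by
    refine le_of_mul_le_mul_right ?_ hUpos
    calc (τ - μ) ^ 2 * (N * poissonMass d μ) * (N * poissonMass d μ)
        = (|τ - μ| * (N * poissonMass d μ)) ^ 2 := by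
          rw [mul_pow, sq_abs]
          ring
      _ ≤ (3 * (ampConst d * ν)) ^ 2 := by gcongr
      _ = 9 * ampConst d ^ 2 * ν ^ 2 := by ring
      _ = _ := by
        rw [hν2]
        ring
  have hδm' := abs_le.1 hδm
  have e1 := sq_mul_poissonGap_sub_le h.lt hN hμ.le hm hm1 h.margin_le hτ0 (by linarith) hτ'
  have e2 := sq_sub_poissonGap_le h.lt hN hμ.le hm.le hm1 h.margin_le h.slack_le h.one_le
    (add_sub_cancel τ (μ + m)) hr (by linarith) hF
  have hb := h.one_le
  have hw := one_le_weightConst j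
  have e3 : 18 * weightConst j * (N * poissonMass d μ) * (N * poissonGap j 0 μ) / m *
      (τ - μ) ^ 2 ≤ 486 * weightConst j * ampConst d ^ 2 * (ω ^ 2 * (N * poissonGap j 0 μ)) := by
    calc 18 * weightConst j * (N * poissonMass d μ) * (N * poissonGap j 0 μ) / m * (τ - μ) ^ 2
        = 18 * weightConst j * (N * poissonGap j 0 μ) / m *
          ((τ - μ) ^ 2 * (N * poissonMass d μ)) := by ring
      _ ≤ 18 * weightConst j * (N * poissonGap j 0 μ) / m *
          (27 * ampConst d ^ 2 * ω ^ 2 * m) := by gcongr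
      _ = _ := by
          field_simp
          ring
  have e4 : (D j - N * poissonGap j 0 μ) ^ 2 ≤ 2 * (D j - N * poissonGap j 0 τ) ^ 2 +
      2 * (N * poissonGap j 0 τ - N * poissonGap j 0 μ) ^ 2 := by
    nlinarith [sq_nonneg ((D j - N * poissonGap j 0 τ) -
      (N * poissonGap j 0 τ - N * poissonGap j 0 μ))]
  rw [devConst]
  linarith

end Admissible

/-! ### Translation to `beta` and `ell`, choice of the margin -/

theorem beta_eq (n : ℕ) (x : ℝ) (i : ℕ) : beta n x i = n * poissonGap i 0 (x / n) := by
  rw [beta, poissonGap_of_le (Nat.zero_le i), Nat.sub_zero]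
  ring

theorem ell_eq (d n : ℕ) (x : ℝ) :
    ell d n x = (d : ℝ) * n / 2 - n * poissonDeficit d (x / n) / 2 := by
  rw [ell, poissonDeficit, Finset.mul_sum, Finset.mul_sum, Finset.sum_div]
  congr 1
  refine Finset.sum_congr rfl fun k _ => ?_
  rw [beta_eq]
  ring

theorem le_poissonDeficit_zero {d : ℕ} (hd : 0 < d) : (d : ℝ) ≤ poissonDeficit d 0 := by
  have h := Finset.single_le_sum (f := fun k : ℕ => ((d : ℝ) - k) * poissonGap k 0 0)
    (s := Finset.range d) (fun k hk => mul_nonneg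
      (sub_nonneg.2 (by exact_mod_cast (Finset.mem_range.1 hk).le)) (poissonGap_nonneg k 0 le_rfl))
    (Finset.mem_range.2 hd)
  rw [poissonDeficit]
  simpa [poissonGap_at_zero] using h

/-- The margin for the target time: it is at most the time unless `j = 0`. -/
theorem exists_admissible {d j : ℕ} (hj : j < d) {N μ : ℝ} (hN : 0 ≤ N) (hμ : 0 < μ)
    (hb : 1 ≤ N * poissonGap j 0 μ) : ∃ m, Admissible d j N μ m := by
  have hU : N * poissonGap j 0 μ ≤ N * poissonMass d μ :=
    mul_le_mul_of_nonneg_left (poissonGap_le_poissonMass hj hμ.le) hN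
  by_cases h : j = 0 ∨ 1 ≤ μ
  · refine ⟨1, hj, hN, hμ, one_pos, le_rfl, h.symm, slack_le_one _, hb, ?_⟩
    rwa [one_mul]
  · push Not at h
    obtain ⟨h0, h1⟩ := h
    -- For `j ≥ 1` and `μ < 1` the margin 1 would exceed `μ`. The margin `μ` works since `slack (2 *
    -- μ) ≤ μ`, and since the weight of degree `j` is at most `μ` times that of degree `j - 1`.
    refine ⟨μ, hj, hN, hμ, hμ, h1.le, Or.inl le_rfl, ?_, hb, ?_⟩
    · have := slack_le_half (μ + μ)
      linarith
    · obtain ⟨k, rfl⟩ := Nat.exists_eq_succ_of_ne_zero h0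
      have h2 : poissonGap (k + 1) 0 μ ≤ μ * poissonGap k 0 μ := by
        rw [poissonGap_of_le (Nat.zero_le _), poissonGap_of_le (Nat.zero_le _), Nat.sub_zero,
          Nat.sub_zero, mul_div_assoc', ← mul_assoc, ← pow_succ']
        gcongr
        omega
      have h3 := poissonGap_le_poissonMass (d := d) (k := k) (by omega) hμ.le
      calc N * poissonGap (k + 1) 0 μ ≤ N * (μ * poissonMass d μ) := by
            gcongr
            exact h2.trans (by gcongr)
        _ = _ := by ring

/-! ### The stopped process and the theorem -/

/-- The total potential of a state, normalized by the squared admissible deviations. -/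
noncomputable def totalPotential {V : Type*} [Fintype V] (d : ℕ) (T ω : ℝ) (G : SimpleGraph V)
    (τ : ℝ) : ℝ :=
  ∑ i ∈ Finset.range d, potential d i (Fintype.card V * poissonGap i 0 T) G (T - τ) /
    (ω ^ 2 * varBound (Fintype.card V) T i)

/-- The constant in the bound for the probability of a large deviation. -/
noncomputable def probConst (d : ℕ) : ℝ :=
  ∑ i ∈ Finset.range d, 4 * sqConst d i * (1 + 4 * driftConst d i)

theorem probConst_nonneg (d : ℕ) : 0 ≤ probConst d :=
  Finset.sum_nonneg fun i _ => by
    have h1 := sqConst_pos d i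
    have h2 := driftConst_nonneg d i
    positivity

section Total

variable {V : Type*} [Fintype V]

theorem totalPotential_summand_nonneg (d i : ℕ) {T ω τ : ℝ} (G : SimpleGraph V) (hT : 0 < T)
    (hτ : τ ≤ T) :
    0 ≤ potential d i (Fintype.card V * poissonGap i 0 T) G (T - τ) /
      (ω ^ 2 * varBound (Fintype.card V) T i) := by
  have h1 := (sq_nonneg _).trans (sq_le_potential d i (Fintype.card V * poissonGap i 0 T) G
    (sub_nonneg.2 hτ))
  have h2 := varBound_pos (Nat.cast_nonneg (Fintype.card V)) hT i
  positivity

theorem sq_transformDev_le_of_totalPotential_lt {d : ℕ} {T ω τ : ℝ} {G : SimpleGraph V}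
    (hT : 0 < T) (hτ : τ ≤ T) (hω : 0 < ω) (h : totalPotential d T ω G τ < 1) {i : ℕ}
    (hi : i < d) :
    transformDev (fun a => (degreeCount G a : ℝ)) (Fintype.card V) (T - τ) T i ^ 2 ≤
      ω ^ 2 * varBound (Fintype.card V) T i := by
  have h1 := (Finset.single_le_sum
    (fun i _ => totalPotential_summand_nonneg d i (ω := ω) G hT hτ)
    (Finset.mem_range.2 hi)).trans_lt h
  have h2 := varBound_pos (Nat.cast_nonneg (Fintype.card V)) hT i
  rw [div_lt_one (by positivity)] at h1
  rw [transformDev, ← gapSum_zero_eq]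
  exact (sq_le_potential d i _ G (sub_nonneg.2 hτ)).trans h1.le

theorem totalPotential_bot_le (d : ℕ) {T ω : ℝ} (hT : 0 < T) (hω : 0 < ω) :
    totalPotential d T ω (⊥ : SimpleGraph V) 0 ≤ probConst d / ω ^ 2 := by
  rw [totalPotential, probConst, Finset.sum_div]
  refine Finset.sum_le_sum fun i _ => ?_
  have h1 := potential_bot_le (V := V) d i hT.le
  have h2 := varBound_pos (Nat.cast_nonneg (Fintype.card V)) hT i
  rw [sub_zero, ← div_div, div_right_comm]
  refine div_le_div_of_nonneg_right ?_ (by positivity)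
  rwa [div_le_iff₀ h2]

theorem pairMean_totalPotential_le {d : ℕ} {T ω τ : ℝ} {G : SimpleGraph V} (hT : 0 < T)
    (hU : 2 * d ≤ (unsaturated d G).card) (hr : clockStep d G ≤ T - τ) :
    pairMean d G (fun e => totalPotential d T ω (addEdge G e) (τ + clockStep d G)) ≤
      totalPotential d T ω G τ := by
  unfold totalPotential
  rw [pairMean_sum_fun]
  refine Finset.sum_le_sum fun i hi => ?_
  have h2 := varBound_pos (Nat.cast_nonneg (Fintype.card V)) hT i
  have h3 := pairMean_potential_le (Finset.mem_range.1 hi) (Fintype.card V * poissonGap i 0 T) hU hr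
  rw [sub_sub] at h3
  simp_rw [div_eq_inv_mul]
  rw [pairMean_const_mul]
  exact mul_le_mul_of_nonneg_left h3 (by positivity)

end Total

/-- While edges are missing, the missing degrees number at least `N * poissonMass d μ ≥ β_j / m`,
and a vertex misses at most `d`. Hence allowed pairs remain, and one step moves the clock by at most
`m / d`. -/
theorem two_mul_le_margin_mul_card {V : Type*} [Fintype V] {d j : ℕ} {μ m : ℝ}
    (h : Admissible d j (Fintype.card V) μ m)
    (hb : 2 * (d : ℝ) ^ 2 ≤ Fintype.card V * poissonGap j 0 μ) {G : SimpleGraph V}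
    (hL : Fintype.card V * poissonDeficit d μ ≤
      ∑ a ∈ Finset.range d, ((d : ℝ) - a) * degreeCount G a) :
    2 * (d : ℝ) ≤ m * (unsaturated d G).card := by
  have hd : (0 : ℝ) < d := by exact_mod_cast Nat.zero_lt_of_lt h.lt
  have hm := h.margin_pos
  have h1 : ∑ a ∈ Finset.range d, ((d : ℝ) - a) * degreeCount G a ≤
      d * (unsaturated d G).card := by
    rw [← sum_degreeCount, Finset.mul_sum]
    refine Finset.sum_le_sum fun a _ => ?_
    gcongr
    linarith [Nat.cast_nonneg (α := ℝ) a]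
  have h2 := mul_le_mul_of_nonneg_left (poissonMass_le_poissonDeficit d h.time_pos.le) h.nonneg
  have h3 := mul_le_mul_of_nonneg_left (h2.trans (hL.trans h1)) hm.le
  have h4 := h.le_margin_mul
  refine le_of_mul_le_mul_right ?_ hd
  linarith

/-- A large-deviation bound for the number of vertices of degree `j` at a fixed step. -/
theorem one_sub_le_prob_graphLaw {d j n s : ℕ} (hd : 2 ≤ d) {μ m ω : ℝ}
    (h : Admissible d j n μ m) (hω : 0 < ω)
    (hωb : 3 * (7 * ampConst d) ^ 2 * ω ^ 2 ≤ n * poissonGap j 0 μ)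
    (hb : 2 * (d : ℝ) ^ 2 ≤ n * poissonGap j 0 μ)
    (hs : (d : ℝ) * n - 2 * s = n * poissonDeficit d μ) :
    1 - probConst d / ω ^ 2 ≤ prob (graphLaw d n s) {G | G.edgeSet.ncard = s ∧
      ((degreeCount G j : ℝ) - n * poissonGap j 0 μ) ^ 2 ≤
        devConst d j * ω ^ 2 * (n * poissonGap j 0 μ)} := by
  have hT : 0 < μ + m := add_pos h.time_pos h.margin_pos
  have hm := h.margin_pos
  have hm1 := h.margin_le_one
  have hμ := h.time_pos
  refine one_sub_le_prob _ _ (div_nonneg (probConst_nonneg d) (by positivity)) ?_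
  rw [← runFrom_bot]
  refine (runFrom_compl_le d s _
    (fun G τ => (∀ v, vertexDegree G v ≤ d) ∧ 0 ≤ τ ∧ τ ≤ μ + m)
    (totalPotential d (μ + m) ω) ?_ ?_ s ⊥ 0 ?_ ?_).trans
    (ENNReal.ofReal_le_ofReal (totalPotential_bot_le d hT hω))
  · rintro G τ ⟨-, -, hτ⟩
    exact Finset.sum_nonneg fun i _ => totalPotential_summand_nonneg d i G hT hτ
  · rintro G τ ⟨hG, hτ0, hτ⟩ hGs
    rw [or_iff_not_imp_left]
    intro hW
    have hF := fun i (hi : i < d) =>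
      sq_transformDev_le_of_totalPotential_lt hT hτ hω (not_le.1 hW) hi
    have hL := sum_sub_mul_degreeCount hG
    rw [Fintype.card_fin] at hF hL
    rcases hGs.eq_or_lt with hGs | hGs
    · left
      rw [hGs, hs] at hL
      exact ⟨hGs, hGs, h.sq_sub_le hωb (fun a => Nat.cast_nonneg _) hτ0 hτ hF hL⟩
    · right
      have hL' : n * poissonDeficit d μ ≤
          ∑ a ∈ Finset.range d, ((d : ℝ) - a) * degreeCount G a := by
        have : (G.edgeSet.ncard : ℝ) ≤ s := by exact_mod_cast hGs.le
        linarith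
      have hclock := h.clock_le hωb hτ hF hL'
      have hU := two_mul_le_margin_mul_card (V := Fin n) (by rwa [Fintype.card_fin])
        (by rwa [Fintype.card_fin]) (by rwa [Fintype.card_fin])
      have hd' : (2 : ℝ) ≤ d := by exact_mod_cast hd
      have hUn : 2 * d ≤ (unsaturated d G).card := by
        have : 2 * (d : ℝ) ≤ (unsaturated d G).card :=
          hU.trans (mul_le_of_le_one_left (Nat.cast_nonneg _) hm1)
        exact_mod_cast this
      have hpos : 0 < (unsaturated d G).card := by omega
      have hstep : clockStep d G ≤ m / 2 := by
        rw [clockStep, div_le_iff₀ (by exact_mod_cast hpos)]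
        linarith
      have hstep0 := clockStep_nonneg d G
      -- The clock is at most `μ + m / 2` and the step at most `m / 2`, so the target time is not
      -- passed.
      refine ⟨hGs, allowedFinset_nonempty hUn hpos,
        fun e he => ⟨vertexDegree_addEdge_le hG he, by linarith, by linarith⟩,
        pairMean_totalPotential_le hT hUn (by linarith)⟩
  · refine ⟨fun v => ?_, le_rfl, hT.le⟩
    simp [vertexDegree, SimpleGraph.neighborSet]
  · simp

theorem theorem1p4 (d j : ℕ) (hd : 2 ≤ d) (hj : j ≤ d - 1) :
    ∃ C : ℝ, ∀ (s : ℕ → ℕ) (x w : ℕ → ℝ),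
      (∀ᶠ n : ℕ in atTop, 1 ≤ s n ∧ (s n : ℝ) ≤ (d : ℝ) * n / 2) →
      -- `x n = ℓ_n⁻¹ (s n)`
      (∀ᶠ n : ℕ in atTop, 0 ≤ x n ∧ ell d n (x n) = s n) →
      Tendsto (fun n : ℕ => beta n (x n) j) atTop atTop →
      Tendsto w atTop atTop →
      w =o[atTop] (fun n : ℕ => √(beta n (x n) j)) →
      ∀ᶠ n : ℕ in atTop,
        1 - C / (w n) ^ 2 ≤
          prob (graphLaw d n (s n))
            {G | G.edgeSet.ncard = s n ∧
              |(degreeCount G j : ℝ) - beta n (x n) j| ≤ w n * √(beta n (x n) j)} := by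
  have hK := devConst_pos d j
  refine ⟨probConst d * devConst d j, fun s x w hs hx hβ hw hwβ => ?_⟩
  set κ : ℝ := 3 * (7 * ampConst d) ^ 2 / devConst d j with hκ
  have hκ0 : 0 ≤ κ := by positivity
  -- With `ω = w / √(devConst d j)` the smallness of `ω` required below reads `κ * w ^ 2 ≤ β_j`; the
  -- little-o hypothesis gives it with `κ + 1`.
  have hc : 0 < √(1 / (κ + 1)) := Real.sqrt_pos.2 (by positivity)
  filter_upwards [hs, hx, hβ.eventually_ge_atTop 1, hβ.eventually_ge_atTop (2 * (d : ℝ) ^ 2),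
    hw.eventually_ge_atTop 1, hwβ.def hc] with n ⟨hs1, _⟩ ⟨hx0, hell⟩ hb1 hb2 hw1 hwb
  rw [ell_eq] at hell
  rw [beta_eq] at *
  have hn : (0 : ℝ) < n := by
    rcases (Nat.cast_nonneg (α := ℝ) n).eq_or_lt with h | h
    · rw [← h, zero_mul] at hb1
      linarith
    · exact h
  have hs1' : (1 : ℝ) ≤ s n := by exact_mod_cast hs1
  -- At time 0 the deficit is at least `d`, which would leave no edge; this contradicts `1 ≤ s n`.
  have hμ : 0 < x n / n := by
    rcases (div_nonneg hx0 hn.le).eq_or_lt with h | h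
    · rw [← h] at hell
      have := mul_le_mul_of_nonneg_left (le_poissonDeficit_zero (d := d) (by omega)) hn.le
      linarith
    · exact h
  obtain ⟨m, hm⟩ := exists_admissible (d := d) (j := j) (by omega) hn.le hμ hb1
  have hw0 : 0 < w n := by linarith
  set b : ℝ := n * poissonGap j 0 (x n / n) with hb
  have hω2 : (w n / √(devConst d j)) ^ 2 = w n ^ 2 / devConst d j := by
    rw [div_pow, Real.sq_sqrt hK.le]
  have hwb2 : w n ^ 2 * (κ + 1) ≤ b := by
    rw [Real.norm_eq_abs, Real.norm_eq_abs, abs_of_pos hw0, abs_of_nonneg (Real.sqrt_nonneg _)]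
      at hwb
    have h1 := pow_le_pow_left₀ hw0.le hwb 2
    rw [mul_pow, Real.sq_sqrt (by positivity), Real.sq_sqrt (by linarith), one_div,
      ← div_eq_inv_mul, le_div_iff₀ (by linarith)] at h1
    exact h1
  have hmain := one_sub_le_prob_graphLaw (s := s n) hd hm (ω := w n / √(devConst d j))
    (div_pos hw0 (Real.sqrt_pos.2 hK)) (by
      rw [hω2]
      have : 3 * (7 * ampConst d) ^ 2 * (w n ^ 2 / devConst d j) = w n ^ 2 * κ := by
        rw [hκ]
        ring
      rw [this]
      nlinarith [sq_nonneg (w n)]) hb2 (by linarith)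
  rw [hω2, ← hb] at hmain
  have e1 : probConst d / (w n ^ 2 / devConst d j) = probConst d * devConst d j / w n ^ 2 := by
    field_simp
  have e2 : ∀ y : ℝ, (y - b) ^ 2 ≤ devConst d j * (w n ^ 2 / devConst d j) * b ↔
      |y - b| ≤ w n * √b := by
    intro y
    have h1 : devConst d j * (w n ^ 2 / devConst d j) * b = (w n * √b) ^ 2 := by
      rw [mul_pow, Real.sq_sqrt (by linarith)]
      field_simp
    rw [h1, sq_le_sq, abs_of_nonneg (mul_nonneg hw0.le (Real.sqrt_nonneg b))]
  simp_rw [e1, e2] at hmain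
  exact hmain
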